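/- Let $\Gamma$ be a finite group acting smoothly and effectively on the circle $S^1$, and let $f:S^1\to\mathbb R$ be a $\Gamma$-invariant Morse function, i.e. a smooth function with $f(\gamma z)=f(z)$ for all $\gamma\in\Gamma$, $z\in S^1$, all of whose critical points are nondegenerate. Let $\mathcal M^{\Gamma}$ denote the set of $\Gamma$-invariant smooth Riemannian metrics on $S^1$, endowed with the $\mathcal C^\infty$ topology. For $g\in\mathcal M^{\Gamma}$ let $\nabla^g f$ be the gradient of $f$ with respect to $g$, defined by $g(\nabla^g f,v)=df(v)$ for every tangent vector $v$. For a smooth vector field $\mathcal X$ on $S^1$ let $\mathrm{Aut}(\mathcal X)=\{\phi\in\mathrm{Diff}(S^1)\mid \phi_*\mathcal X=\mathcal X\}$ be the group of smooth diffeomorphisms preserving $\mathcal X$, and let $\mathrm{Aut}(\mathcal X)/\mathbb R$ be its quotient by the central subgroup consisting of the time-$t$ flow maps of $\mathcal X$, $t\in\mathbb R$. Then there exists an open and dense subset $\mathcal M_f\subset\mathcal M^{\Gamma}$ such that for every $g\in\mathcal M_f$ there is a group isomorphism $\mathrm{Aut}(\nabla^g f)/\mathbb R\simeq\Gamma$.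 -/

import Mathlib

open scoped Manifold ContDiff

namespace CircleGradient

/-- Vector fields on the circle `S¹` (Mathlib's `Circle`, with its smooth structure). -/
abbrev VField : Type := (z : Circle) → TangentSpace (𝓡 1) z

/-- Smooth Riemannian metrics on the circle. -/
abbrev Metric : Type :=
  Bundle.ContMDiffRiemannianMetric (𝓡 1) ∞ (EuclideanSpace ℝ (Fin 1))
    (fun z : Circle => TangentSpace (𝓡 1) z)

/-- Smooth diffeomorphisms of the circle. -/
abbrev Diff : Type := Circle ≃ₘ⟮𝓡 1, 𝓡 1⟯ Circle

/-! ### The topology on metrics -/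

/-- The coordinate vector `∂_θ` at the point `exp(iθ)`: the velocity of `θ ↦ exp(iθ)`. -/
noncomputable def angleVector (θ : ℝ) : TangentSpace (𝓡 1) (Circle.exp θ) :=
  mfderiv 𝓘(ℝ, ℝ) (𝓡 1) (fun t : ℝ => Circle.exp t) θ (1 : ℝ)

/-- The coefficient `a(θ) = g(∂_θ, ∂_θ)` of the metric `g = a(θ) dθ²` in the angular coordinate. -/
noncomputable def Metric.coeff (g : Metric) (θ : ℝ) : ℝ :=
  g.inner (Circle.exp θ) (angleVector θ) (angleVector θ)

/-- The `C^∞` topology on the set of metrics: uniform convergence of the coefficient in the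
angular coordinate together with each of its derivatives. -/
noncomputable instance instTopologicalSpaceMetric : TopologicalSpace Metric :=
  TopologicalSpace.induced
    (fun g : Metric => fun k : ℕ => UniformFun.ofFun (iteratedDeriv k (Metric.coeff g)))
    (inferInstance : TopologicalSpace (ℕ → UniformFun ℝ ℝ))

/-- The metrics invariant under an action of `Γ` on the circle: each `γ : Γ` acts by an isometry.
This is a topological space with the subspace topology. -/
def invariantMetrics (Γ : Type*) [SMul Γ Circle] : Set Metric :=
  {g | ∀ (γ : Γ) (z : Circle) (v w : TangentSpace (𝓡 1) z),
    g.inner (γ • z) (mfderiv (𝓡 1) (𝓡 1) (fun y : Circle => γ • y) z v)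
      (mfderiv (𝓡 1) (𝓡 1) (fun y : Circle => γ • y) z w) = g.inner z v w}

/-! ### Morse functions and gradients -/

/-- A Morse function on the circle: a smooth function whose critical points are all
nondegenerate (first and second derivatives are taken in the angular coordinate). -/
def IsMorse (f : Circle → ℝ) : Prop :=
  ContMDiff (𝓡 1) 𝓘(ℝ, ℝ) ∞ f ∧
    ∀ θ : ℝ, deriv (fun t : ℝ => f (Circle.exp t)) θ = 0 →
      iteratedDeriv 2 (fun t : ℝ => f (Circle.exp t)) θ ≠ 0

theorem exists_gradient (g : Metric) (f : Circle → ℝ) (z : Circle) :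
    ∃ u : TangentSpace (𝓡 1) z, ∀ v : TangentSpace (𝓡 1) z,
      g.inner z u v = mfderiv (𝓡 1) 𝓘(ℝ, ℝ) f z v := by
  have : FiniteDimensional ℝ (TangentSpace (𝓡 1) z) :=
    inferInstanceAs (FiniteDimensional ℝ (EuclideanSpace ℝ (Fin 1)))
  let B : TangentSpace (𝓡 1) z →ₗ[ℝ] Module.Dual ℝ (TangentSpace (𝓡 1) z) :=
    { toFun := fun u => (g.inner z u).toLinearMap
      map_add' := fun u v => by
        ext w
        simp
      map_smul' := fun r u => by
        ext w
        simp }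
  have hB : ∀ u v, B u v = g.inner z u v := fun _ _ => rfl
  have hinj : Function.Injective B := by
    rw [injective_iff_map_eq_zero]
    intro u hu
    by_contra hne
    have h := g.pos z u hne
    rw [← hB, hu] at h
    exact lt_irrefl _ h
  have hsurj : Function.Surjective B :=
    (LinearMap.injective_iff_surjective_of_finrank_eq_finrank
      (Subspace.dual_finrank_eq (K := ℝ) (V := TangentSpace (𝓡 1) z)).symm).1 hinj
  obtain ⟨u, hu⟩ := hsurj (mfderiv (𝓡 1) 𝓘(ℝ, ℝ) f z).toLinearMap
  refine ⟨u, fun v => ?_⟩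
  rw [← hB, hu]
  rfl

/-- The gradient `∇^g f`, the vector field with `g(∇^g f, v) = df(v)` for all tangent
vectors `v`. -/
noncomputable def grad (g : Metric) (f : Circle → ℝ) : VField :=
  fun z => Classical.choose (exists_gradient g f z)

theorem grad_spec (g : Metric) (f : Circle → ℝ) (z : Circle) (v : TangentSpace (𝓡 1) z) :
    g.inner z (grad g f z) v = mfderiv (𝓡 1) 𝓘(ℝ, ℝ) f z v :=
  Classical.choose_spec (exists_gradient g f z) v

/-! ### Automorphisms of a vector field, and its flow -/

/-- `Diff(S¹)` is a group under composition. -/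
noncomputable instance instGroupDiff : Group Diff where
  mul φ ψ := ψ.trans φ
  one := Diffeomorph.refl (𝓡 1) Circle ∞
  inv φ := φ.symm
  mul_assoc _ _ _ := rfl
  one_mul _ := Diffeomorph.ext fun _ => rfl
  mul_one _ := Diffeomorph.ext fun _ => rfl
  inv_mul_cancel φ := Diffeomorph.ext fun x => φ.symm_apply_apply x

theorem mul_apply (φ ψ : Diff) (z : Circle) : (φ * ψ) z = φ (ψ z) := rfl

theorem one_apply (z : Circle) : (1 : Diff) z = z := rfl

theorem inv_apply_self (φ : Diff) (z : Circle) : φ⁻¹ (φ z) = z := φ.symm_apply_apply z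

theorem apply_inv_self (φ : Diff) (z : Circle) : φ (φ⁻¹ z) = z := φ.apply_symm_apply z

theorem diff_hasMFDerivAt (φ : Diff) (z : Circle) :
    HasMFDerivAt (𝓡 1) (𝓡 1) φ z (mfderiv (𝓡 1) (𝓡 1) φ z) :=
  (φ.mdifferentiable (by simp) z).hasMFDerivAt

theorem mfderiv_mul (φ ψ : Diff) (z : Circle) (v : TangentSpace (𝓡 1) z) :
    mfderiv (𝓡 1) (𝓡 1) (φ * ψ : Diff) z v =
      mfderiv (𝓡 1) (𝓡 1) φ (ψ z) (mfderiv (𝓡 1) (𝓡 1) ψ z v) := by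
  have h := ((diff_hasMFDerivAt φ (ψ z)).comp z (diff_hasMFDerivAt ψ z)).mfderiv
  have h' : mfderiv (𝓡 1) (𝓡 1) (φ * ψ : Diff) z = _ := h
  rw [h']
  rfl

theorem mfderiv_one (z : Circle) (v : TangentSpace (𝓡 1) z) :
    mfderiv (𝓡 1) (𝓡 1) (1 : Diff) z v = v := by
  have h : mfderiv (𝓡 1) (𝓡 1) (1 : Diff) z = _ := (hasMFDerivAt_id (I := 𝓡 1) z).mfderiv
  rw [h]
  rfl

/-- `Aut(X)`: the diffeomorphisms `φ` with `φ_* X = X`, that is `dφ_z (X z) = X (φ z)` for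
all `z`. -/
noncomputable def Aut (X : VField) : Subgroup Diff where
  carrier := {φ | ∀ z : Circle, mfderiv (𝓡 1) (𝓡 1) φ z (X z) = X (φ z)}
  mul_mem' {φ ψ} hφ hψ z := by
    rw [mfderiv_mul, hψ z, hφ (ψ z), mul_apply]
  one_mem' z := mfderiv_one z (X z)
  inv_mem' {φ} hφ z := by
    obtain ⟨y, rfl⟩ : ∃ y, φ y = z := ⟨φ⁻¹ z, apply_inv_self φ z⟩
    rw [← hφ y, ← mfderiv_mul, inv_apply_self]
    have h : (φ⁻¹ * φ : Diff) = 1 := inv_mul_cancel φ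
    rw [h]
    exact mfderiv_one y (X y)

/-- The subgroup of `Aut(X)` of all time-`t` flow maps of `X`, `t` a real number. A
diffeomorphism is the time-`t` flow map of `X` when it advances every integral curve of `X` by
time `t`. (A smooth vector field on the circle is complete, so there is an integral curve defined
on all of `ℝ` through every point, and this determines the diffeomorphism.) -/
noncomputable def flowSubgroup (X : VField) : Subgroup (Aut X) where
  carrier := {φ | ∃ t : ℝ, ∀ c : ℝ → Circle, IsMIntegralCurve (I := 𝓡 1) c X →
    ∀ s : ℝ, (φ : Diff) (c s) = c (s + t)}
  mul_mem' {φ ψ} := by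
    rintro ⟨t, ht⟩ ⟨u, hu⟩
    refine ⟨u + t, fun c hc s => ?_⟩
    rw [Subgroup.coe_mul, mul_apply, hu c hc, ht c hc, add_assoc]
  one_mem' := ⟨0, fun c _ s => by rw [add_zero]; rfl⟩
  inv_mem' {φ} := by
    rintro ⟨t, ht⟩
    refine ⟨-t, fun c hc s => ?_⟩
    have h := ht c hc (s + -t)
    rw [neg_add_cancel_right] at h
    rw [← h, Subgroup.coe_inv, inv_apply_self]

theorem isMIntegralCurve_comp {X : VField} (φ : Aut X) {c : ℝ → Circle}
    (hc : IsMIntegralCurve (I := 𝓡 1) c X) :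
    IsMIntegralCurve (I := 𝓡 1) (fun t => (φ : Diff) (c t)) X := by
  intro t
  have h := (diff_hasMFDerivAt (φ : Diff) (c t)).comp t (hc t)
  have e : (mfderiv (𝓡 1) (𝓡 1) (φ : Diff) (c t)).comp
      ((1 : ℝ →L[ℝ] ℝ).smulRight (X (c t))) =
      (1 : ℝ →L[ℝ] ℝ).smulRight (X ((φ : Diff) (c t))) := by
    rw [← φ.2 (c t)]
    ext
    simp
  exact h.congr_mfderiv e

instance flowSubgroup_normal (X : VField) : (flowSubgroup X).Normal where
  conj_mem := by
    rintro ψ ⟨t, ht⟩ φ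
    refine ⟨t, fun c hc s => ?_⟩
    have h := ht _ (isMIntegralCurve_comp φ⁻¹ hc) s
    rw [Subgroup.coe_mul, Subgroup.coe_mul, mul_apply, mul_apply, h, Subgroup.coe_inv,
      apply_inv_self]

/-- The quotient group `Aut(X)/ℝ` of `Aut(X)` by the flow of `X`. -/
abbrev AutModFlow (X : VField) : Type := Aut X ⧸ flowSubgroup X

end CircleGradient

namespace CircleGradient

open Set Filter Topology MeasureTheory

/-! ### Functions on the line with simple zeros -/

/-! In the angular coordinate, with `k` the derivative of `f` and `a` the coefficient of `g`, the
gradient is `(k / a) ∂_θ`, and a diffeomorphism with lift `Φ` is an automorphism iff `Φ` conjugates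
`k / a` to itself (`mem_Aut_iff`).

The main tool is a time function, a primitive of `a / k` on the line. At a zero of `k` it has a
logarithmic singularity with coefficient `a / k'`, the reciprocal of the eigenvalue of the
linearization. Since automorphisms preserve eigenvalues, the singularities cancel in `timeFn ∘ Φ -
timeFn`, which therefore extends continuously across the zeros and is one constant on the whole line
(`exists_timeFn_comp`). This has two consequences. An increasing `Φ` fixing all zeros is the flow
map of a single time on all intervals between zeros (`exists_flow_time`). And if `P` is the
increment of the time function over a period, a lift of degree `n` satisfies `n * P = P`, so `P ≠ 0`
excludes orientation reversing automorphisms (`mul_principalValue`).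

Elements of `Γ` are automorphisms, and none but the identity is a flow map, because `f` is strictly
monotone along nonconstant trajectories (`eq_one_of_mem_flowSubgroup`). For the converse, fix a
critical point `p`. For generic `g`, critical points outside the orbit of `p` have other eigenvalues
than `p`, so every automorphism keeps `p` in its orbit. After correction by elements of `Γ` it
preserves orientation and fixes `p`, hence fixes all critical points and is a flow map. If `Γ`
contains a reversing element, that element corrects orientation, and `p` is taken to be one of its
fixed points. Otherwise `P ≠ 0` is imposed as a second generic condition.

Both conditions say that a continuous functional, linear in `a`, is nonzero; density follows from
invariant conformal perturbations `(1 + s η) g` (`dense_ne_zero`). -/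

theorem deriv_periodic {f : ℝ → ℝ} {T : ℝ} (hf : Function.Periodic f T) :
    Function.Periodic (deriv f) T := fun y => by
  rw [← deriv_comp_add_const]
  exact congrArg (fun f => deriv f y) (funext hf)

/-- A smooth function on the line all of whose zeros are simple. -/
structure SimpleZeros (k : ℝ → ℝ) : Prop where
  smooth : ContDiff ℝ ∞ k
  simple : ∀ x, k x = 0 → deriv k x ≠ 0

/-- The coefficient of `k'` in the identity `k' * u + k * v = 1`. -/
noncomputable def bezoutDeriv (k : ℝ → ℝ) (x : ℝ) : ℝ :=
  deriv k x / (k x ^ 2 + deriv k x ^ 2)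

/-- The coefficient of `k` in the identity `k' * u + k * v = 1`. -/
noncomputable def bezoutSelf (k : ℝ → ℝ) (x : ℝ) : ℝ :=
  k x / (k x ^ 2 + deriv k x ^ 2)

namespace SimpleZeros

variable {k : ℝ → ℝ}

theorem hasDerivAt (hk : SimpleZeros k) (x : ℝ) : HasDerivAt k (deriv k x) x :=
  (hk.smooth.differentiable (by simp) x).hasDerivAt

theorem smooth_deriv (hk : SimpleZeros k) : ContDiff ℝ ∞ (deriv k) :=
  hk.smooth.iterate_deriv 1

theorem eventually_ne (hk : SimpleZeros k) (x : ℝ) : ∀ᶠ y in 𝓝[≠] x, k y ≠ 0 := by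
  by_cases hx : k x = 0
  · exact (hk.hasDerivAt x).eventually_ne (hk.simple x hx)
  · exact (hk.smooth.continuous.continuousAt.eventually_ne hx).filter_mono nhdsWithin_le_nhds

theorem discreteTopology (hk : SimpleZeros k) : DiscreteTopology {x | k x = 0} := by
  rw [discreteTopology_subtype_iff]
  intro x _
  rw [← disjoint_iff, disjoint_principal_right]
  filter_upwards [hk.eventually_ne x] with y hy using hy

theorem isClosed (hk : SimpleZeros k) : IsClosed {x | k x = 0} :=
  isClosed_eq hk.smooth.continuous continuous_const

theorem countable (hk : SimpleZeros k) : {x | k x = 0}.Countable := by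
  have := hk.discreteTopology
  exact countable_coe_iff.1 (countable_of_Lindelof_of_discrete (X := {x | k x = 0}))

theorem finite_Icc (hk : SimpleZeros k) (a b : ℝ) : (Icc a b ∩ {x | k x = 0}).Finite := by
  refine (isCompact_Icc.inter_right hk.isClosed).finite ?_
  have := hk.discreteTopology
  exact (isDiscrete_iff_discreteTopology.2 this).mono inter_subset_right

theorem isBigO_sub (hk : SimpleZeros k) {p : ℝ} (hp : k p = 0) :
    (fun x => x - p) =O[𝓝 p] k := by
  have h := (hk.hasDerivAt p).isTheta_sub (hk.simple p hp)
  simpa [hp, Function.comp_def] using h.2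

/-- The product of a function vanishing at the zeros of `k` with `log |k|` is continuous. -/
theorem continuous_mul_log (hk : SimpleZeros k) {w : ℝ → ℝ} (hw : Differentiable ℝ w)
    (h0 : ∀ x, k x = 0 → w x = 0) : Continuous fun x => w x * Real.log (k x) := by
  rw [continuous_iff_continuousAt]
  intro p
  by_cases hp : k p = 0
  · have h1 : w =O[𝓝 p] k := by
      refine Asymptotics.IsBigO.trans ?_ (hk.isBigO_sub hp)
      simpa [h0 p hp] using (hw p).hasDerivAt.isBigO_sub
    have h2 : (fun x => w x * Real.log (k x)) =O[𝓝 p] fun x => k x * Real.log (k x) :=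
      h1.mul (Asymptotics.isBigO_refl _ _)
    have h3 : Tendsto (fun x => k x * Real.log (k x)) (𝓝 p) (𝓝 0) := by
      have := (Real.continuous_mul_log.comp hk.smooth.continuous).tendsto p
      simpa [hp, Function.comp_def] using this
    have := h2.trans_tendsto h3
    simpa [ContinuousAt, h0 p hp] using this
  · exact hw.continuous.continuousAt.mul (hk.smooth.continuous.continuousAt.log hp)

/-- Near a simple zero `p`, `log |k|` is `log |x - p|` plus the logarithm of a slope with nonzero
limit, which is bounded. -/
theorem locallyIntegrable_log (hk : SimpleZeros k) :
    LocallyIntegrable (fun x => Real.log (k x)) := by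
  intro p
  have hm : Measurable fun x => Real.log (k x) :=
    Real.measurable_log.comp hk.smooth.continuous.measurable
  by_cases hp : k p = 0
  · have hd := hk.simple p hp
    set l : ℝ → ℝ := fun x => Real.log (k x) - Real.log (x - p) with hl
    have hlim : Tendsto l (𝓝[≠] p) (𝓝 (Real.log (deriv k p))) := by
      have h1 := (hasDerivAt_iff_tendsto_slope.1 (hk.hasDerivAt p)).log hd
      refine h1.congr' ?_
      filter_upwards [hk.eventually_ne p, self_mem_nhdsWithin] with x hx hxp
      have : x - p ≠ 0 := sub_ne_zero.2 hxp
      rw [slope_def_field, hp, sub_zero, Real.log_div hx this]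
    obtain ⟨C, hC⟩ := hlim.norm.isBoundedUnder_le
    rw [eventually_map, eventually_nhdsWithin_iff, Metric.eventually_nhds_iff_ball] at hC
    obtain ⟨ε, hε, hC⟩ := hC
    refine ⟨Metric.ball p ε, Metric.ball_mem_nhds p hε, ?_⟩
    have hlog : IntegrableOn (fun x => Real.log (x - p)) (Metric.ball p ε) := by
      have h : IntervalIntegrable (fun x => Real.log (x - p)) volume (p - ε) (p + ε) := by
        have := (intervalIntegral.intervalIntegrable_log' (a := -ε) (b := ε)).comp_sub_right p
        convert this using 1 <;> ring
      rw [intervalIntegrable_iff_integrableOn_Ioo_of_le (by linarith)] at h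
      rwa [Real.ball_eq_Ioo]
    have hb : IntegrableOn l (Metric.ball p ε) := by
      refine Measure.integrableOn_of_bounded (M := C) measure_ball_lt_top.ne ?_ ?_
      · exact (hm.sub (Real.measurable_log.comp (measurable_id.sub_const p))).aestronglyMeasurable
      · have : ∀ᵐ x : ℝ, x ≠ p := by simp [ae_iff, measure_singleton]
        rw [ae_restrict_iff' Metric.isOpen_ball.measurableSet]
        filter_upwards [this] with x hx hxb using hC x hxb hx
    refine (hb.add hlog).congr_fun (fun x _ => ?_) Metric.isOpen_ball.measurableSet
    simp [hl]
  · have hc : ContinuousAt (fun x => Real.log (k x)) p := hk.smooth.continuous.continuousAt.log hp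
    exact hc.tendsto.integrableAtFilter (hm.stronglyMeasurable.stronglyMeasurableAtFilter)
      (volume.finiteAt_nhds p)

theorem sq_add_sq_pos (hk : SimpleZeros k) (x : ℝ) : 0 < k x ^ 2 + deriv k x ^ 2 := by
  by_cases h : k x = 0
  · have := hk.simple x h
    positivity
  · positivity

theorem bezout (hk : SimpleZeros k) (x : ℝ) :
    bezoutDeriv k x * deriv k x + bezoutSelf k x * k x = 1 := by
  have := (hk.sq_add_sq_pos x).ne'
  rw [bezoutDeriv, bezoutSelf]
  field_simp
  ring

theorem bezoutDeriv_of_eq_zero {x : ℝ} (hx : k x = 0) : bezoutDeriv k x = (deriv k x)⁻¹ := by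
  rw [bezoutDeriv, hx, zero_pow two_ne_zero, zero_add, pow_two, div_self_mul_self']

theorem bezoutDeriv_smooth (hk : SimpleZeros k) : ContDiff ℝ ∞ (bezoutDeriv k) :=
  hk.smooth_deriv.div ((hk.smooth.pow 2).add (hk.smooth_deriv.pow 2))
    fun x => (hk.sq_add_sq_pos x).ne'

theorem bezoutSelf_smooth (hk : SimpleZeros k) : ContDiff ℝ ∞ (bezoutSelf k) :=
  hk.smooth.div ((hk.smooth.pow 2).add (hk.smooth_deriv.pow 2))
    fun x => (hk.sq_add_sq_pos x).ne'

end SimpleZeros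

/-! ### The regularized time function and its principal value -/

/-- An integrable function that differs from `a / k` by the derivative of
`a * bezoutDeriv k * log |k|` away from the zeros of `k`. -/
noncomputable def regDensity (k a : ℝ → ℝ) (x : ℝ) : ℝ :=
  a x * bezoutSelf k x - deriv (fun y => a y * bezoutDeriv k y) x * Real.log (k x)

/-- A regularized primitive of `a / k`. -/
noncomputable def timeFn (k a : ℝ → ℝ) (x : ℝ) : ℝ :=
  (∫ t in (0 : ℝ)..x, regDensity k a t) + a x * bezoutDeriv k x * Real.log (k x)

/-- The principal value of the integral of `a / k` over a period. -/
noncomputable def principalValue (k a : ℝ → ℝ) : ℝ :=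
  ∫ t in (0 : ℝ)..2 * Real.pi, regDensity k a t

namespace SimpleZeros

variable {k a : ℝ → ℝ}

theorem weight_smooth (hk : SimpleZeros k) (ha : ContDiff ℝ ∞ a) :
    ContDiff ℝ ∞ fun y => a y * bezoutDeriv k y :=
  ha.mul hk.bezoutDeriv_smooth

theorem continuous_deriv_of_smooth {w : ℝ → ℝ} (hw : ContDiff ℝ ∞ w) : Continuous (deriv w) :=
  hw.continuous_deriv (by simp)

theorem intervalIntegrable_mul_log (hk : SimpleZeros k) {w : ℝ → ℝ} (hw : Continuous w)
    (x y : ℝ) : IntervalIntegrable (fun t => w t * Real.log (k t)) volume x y :=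
  IntervalIntegrable.continuousOn_mul
    (hk.locallyIntegrable_log.integrableOn_isCompact isCompact_uIcc).intervalIntegrable
    hw.continuousOn

theorem intervalIntegrable_regDensity (hk : SimpleZeros k) (ha : ContDiff ℝ ∞ a) (x y : ℝ) :
    IntervalIntegrable (regDensity k a) volume x y :=
  ((ha.continuous.mul hk.bezoutSelf_smooth.continuous).intervalIntegrable x y).sub
    (hk.intervalIntegrable_mul_log (continuous_deriv_of_smooth (hk.weight_smooth ha)) x y)

theorem continuousAt_regDensity (hk : SimpleZeros k) (ha : ContDiff ℝ ∞ a) {x : ℝ}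
    (hx : k x ≠ 0) : ContinuousAt (regDensity k a) x :=
  (ha.continuous.mul hk.bezoutSelf_smooth.continuous).continuousAt.sub
    ((continuous_deriv_of_smooth (hk.weight_smooth ha)).continuousAt.mul
      (hk.smooth.continuous.continuousAt.log hx))

theorem measurable_regDensity (hk : SimpleZeros k) (ha : ContDiff ℝ ∞ a) :
    Measurable (regDensity k a) :=
  (ha.continuous.mul hk.bezoutSelf_smooth.continuous).measurable.sub
    ((continuous_deriv_of_smooth (hk.weight_smooth ha)).measurable.mul
      (Real.measurable_log.comp hk.smooth.continuous.measurable))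

theorem continuous_integral_regDensity (hk : SimpleZeros k) (ha : ContDiff ℝ ∞ a) :
    Continuous fun x => ∫ t in (0 : ℝ)..x, regDensity k a t :=
  intervalIntegral.continuous_primitive (hk.intervalIntegrable_regDensity ha) 0

/-- The terms containing `log |k|` cancel by the product rule, and the Bézout identity divided by
`k` turns the remaining ones into `a / k`. -/
theorem hasDerivAt_timeFn (hk : SimpleZeros k) (ha : ContDiff ℝ ∞ a) {x : ℝ} (hx : k x ≠ 0) :
    HasDerivAt (timeFn k a) (a x / k x) x := by
  have h1 : HasDerivAt (fun x => ∫ t in (0 : ℝ)..x, regDensity k a t) (regDensity k a x) x :=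
    intervalIntegral.integral_hasDerivAt_right (hk.intervalIntegrable_regDensity ha 0 x)
      (hk.measurable_regDensity ha).stronglyMeasurable.stronglyMeasurableAtFilter
      (hk.continuousAt_regDensity ha hx)
  have h2 : HasDerivAt (fun y => a y * bezoutDeriv k y) _ x :=
    ((hk.weight_smooth ha).differentiable (by simp) x).hasDerivAt
  have h3 := h1.add (h2.mul ((hk.hasDerivAt x).log hx))
  refine HasDerivAt.congr_deriv (f := timeFn k a) h3 ?_
  have := hk.bezout x
  simp only [regDensity]
  field_simp
  linear_combination a x * this

theorem timeFn_add_period (hk : SimpleZeros k) (ha : ContDiff ℝ ∞ a)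
    (hkp : Function.Periodic k (2 * Real.pi)) (hap : Function.Periodic a (2 * Real.pi)) (x : ℝ) :
    timeFn k a (x + 2 * Real.pi) = timeFn k a x + principalValue k a := by
  have hd := deriv_periodic hkp
  have hu : Function.Periodic (bezoutDeriv k) (2 * Real.pi) := fun y => by
    simp [bezoutDeriv, hkp y, hd y]
  have hv : Function.Periodic (bezoutSelf k) (2 * Real.pi) := fun y => by
    simp [bezoutSelf, hkp y, hd y]
  have hw : Function.Periodic (deriv fun y => a y * bezoutDeriv k y) (2 * Real.pi) :=
    deriv_periodic (hap.mul hu)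
  have hr : Function.Periodic (regDensity k a) (2 * Real.pi) := fun y => by
    simp only [regDensity, hap y, hv y, hw y, hkp y]
  have hi := hk.intervalIntegrable_regDensity ha
  have h1 := hr.intervalIntegral_add_eq 0 x
  rw [zero_add] at h1
  rw [timeFn, timeFn, principalValue, h1, hap x, hu x, hkp x,
    ← intervalIntegral.integral_add_adjacent_intervals (hi 0 x) (hi x _)]
  ring

theorem timeFn_add_zsmul (hk : SimpleZeros k) (ha : ContDiff ℝ ∞ a)
    (hkp : Function.Periodic k (2 * Real.pi)) (hap : Function.Periodic a (2 * Real.pi)) (x : ℝ)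
    (n : ℤ) : timeFn k a (x + n * (2 * Real.pi)) = timeFn k a x + n * principalValue k a := by
  induction n using Int.induction_on with
  | zero => simp
  | succ i ih =>
    have := hk.timeFn_add_period ha hkp hap (x + (i : ℤ) * (2 * Real.pi))
    rw [ih] at this
    push_cast at this ⊢
    rw [add_mul, one_mul, ← add_assoc, this]
    ring
  | pred i ih =>
    have := hk.timeFn_add_period ha hkp hap (x + (-(i : ℤ) - 1 : ℤ) * (2 * Real.pi))
    have e : x + ((-(i : ℤ) - 1 : ℤ) : ℝ) * (2 * Real.pi) + 2 * Real.pi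
        = x + ((-(i : ℤ) : ℤ) : ℝ) * (2 * Real.pi) := by push_cast; ring
    rw [e, ih] at this
    push_cast at this ⊢
    linarith

/-- Continuity across the exceptional points forces the constants on adjacent intervals to agree. -/
theorem const_of_hasDerivAt_zero_off_countable {t : ℝ → ℝ} {s : Set ℝ} (hs : s.Countable)
    (hc : Continuous t) (hd : ∀ x ∉ s, HasDerivAt t 0 x) (x y : ℝ) : t x = t y := by
  have := MeasureTheory.integral_eq_of_hasDerivAt_off_countable t (fun _ => 0) (a := x) (b := y) hs
    hc.continuousOn (fun z hz => hd z hz.2) (by simp)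
  simp only [intervalIntegral.integral_zero] at this
  linarith

/-- The derivative of `k / a` at a zero is preserved by transformations that preserve `k / a`. -/
theorem deriv_map_mul (hk : SimpleZeros k) (ha : ContDiff ℝ ∞ a) {Φ : ℝ → ℝ}
    (hΦ : ContDiff ℝ ∞ Φ) {x : ℝ} (hΦ0 : deriv Φ x ≠ 0)
    (hconj : ∀ x, k (Φ x) * a x = deriv Φ x * k x * a (Φ x)) (hx : k x = 0)
    (hx' : k (Φ x) = 0) : deriv k (Φ x) * a x = a (Φ x) * deriv k x := by
  have hΦd := (hΦ.differentiable (by simp) x).hasDerivAt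
  have had := fun y => (ha.differentiable (by simp) y).hasDerivAt
  -- Differentiate both sides of `hconj` at `x`; every term that still contains `k` vanishes.
  have h1 := ((hk.hasDerivAt (Φ x)).comp x hΦd).mul (had x)
  have h2 := ((((hΦ.iterate_deriv 1).differentiable (by simp) x).hasDerivAt).mul
    (hk.hasDerivAt x)).mul ((had (Φ x)).comp x hΦd)
  have h3 := (h1.congr_of_eventuallyEq (f₁ := fun x => deriv Φ x * k x * a (Φ x))
    (Eventually.of_forall fun y => (hconj y).symm)).unique h2
  simp only [Function.iterate_one, Function.comp_apply, Pi.mul_apply, hx, hx', mul_zero, zero_mul,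
    zero_add, add_zero] at h3
  exact mul_left_cancel₀ hΦ0 (by linear_combination h3)

/-- A transformation `Φ` that preserves the vector field `k / a` advances the regularized time
function by a constant. -/
theorem exists_timeFn_comp (hk : SimpleZeros k) (ha : ContDiff ℝ ∞ a) (hpos : ∀ x, 0 < a x)
    {Φ : ℝ → ℝ} (hΦ : ContDiff ℝ ∞ Φ) (hΦ0 : ∀ x, deriv Φ x ≠ 0)
    (hconj : ∀ x, k (Φ x) * a x = deriv Φ x * k x * a (Φ x)) :
    ∃ t₀, ∀ x, k x ≠ 0 → timeFn k a (Φ x) = timeFn k a x + t₀ := by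
  have hΦd : ∀ x, HasDerivAt Φ (deriv Φ x) x := fun x =>
    (hΦ.differentiable (by simp) x).hasDerivAt
  set b : ℝ → ℝ := fun y => a y * bezoutDeriv k y with hb
  have hbs : ContDiff ℝ ∞ b := hk.weight_smooth ha
  set r : ℝ → ℝ := fun x => deriv Φ x * a (Φ x) / a x with hr
  have hrs : ContDiff ℝ ∞ r :=
    ((hΦ.iterate_deriv 1).mul (ha.comp hΦ)).div ha fun x => (hpos x).ne'
  have hr0 : ∀ x, r x ≠ 0 := fun x =>
    div_ne_zero (mul_ne_zero (hΦ0 x) (hpos _).ne') (hpos x).ne'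
  have hkr : ∀ x, k (Φ x) = r x * k x := fun x => by
    have := hconj x
    have h := (hpos x).ne'
    simp only [hr]
    field_simp
    linarith
  -- At a zero of `k`, `b` is `a / k'`, the inverse eigenvalue, which `Φ` preserves. Hence the
  -- logarithmic singularities of `timeFn ∘ Φ` and `timeFn` cancel.
  have hbz : ∀ x, k x = 0 → b (Φ x) - b x = 0 := by
    intro x hx
    have hx' : k (Φ x) = 0 := by rw [hkr, hx, mul_zero]
    have h5 := hk.deriv_map_mul ha hΦ (hΦ0 x) hconj hx hx'
    have d1 := hk.simple x hx
    have d2 := hk.simple _ hx'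
    simp only [hb, bezoutDeriv_of_eq_zero hx, bezoutDeriv_of_eq_zero hx']
    field_simp
    linear_combination -h5
  -- This is `timeFn ∘ Φ - timeFn` rewritten with `log |k ∘ Φ| = log |r| + log |k|`, a form that is
  -- continuous also at the zeros.
  set t : ℝ → ℝ := fun x => (∫ s in (0 : ℝ)..Φ x, regDensity k a s)
    - (∫ s in (0 : ℝ)..x, regDensity k a s)
    + ((b (Φ x) - b x) * Real.log (k x) + b (Φ x) * Real.log (r x)) with ht
  have htc : Continuous t := by
    have hM := hk.continuous_integral_regDensity ha
    have h1 := hk.continuous_mul_log (w := fun x => b (Φ x) - b x)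
      (((hbs.comp hΦ).sub hbs).differentiable (by simp)) hbz
    exact ((hM.comp hΦ.continuous).sub hM).add
      (h1.add ((hbs.continuous.comp hΦ.continuous).mul (hrs.continuous.log hr0)))
  have hteq : ∀ x, k x ≠ 0 → t x = timeFn k a (Φ x) - timeFn k a x := by
    intro x hx
    simp only [ht, timeFn]
    rw [hkr x, Real.log_mul (hr0 x) hx]
    simp only [hb]
    ring
  have htd : ∀ x ∉ {x | k x = 0}, HasDerivAt t 0 x := by
    intro x hx
    have hx : k x ≠ 0 := hx
    have hx' : k (Φ x) ≠ 0 := by rw [hkr]; exact mul_ne_zero (hr0 x) hx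
    have h1 := ((hk.hasDerivAt_timeFn ha hx').comp x (hΦd x)).sub (hk.hasDerivAt_timeFn ha hx)
    have h2 : a (Φ x) / k (Φ x) * deriv Φ x - a x / k x = 0 := by
      have := hconj x
      field_simp
      linarith
    rw [h2] at h1
    refine h1.congr_of_eventuallyEq ?_
    filter_upwards [hk.smooth.continuous.continuousAt.eventually_ne hx] with y hy
      using hteq y hy
  refine ⟨t 0, fun x hx => ?_⟩
  rw [← const_of_hasDerivAt_zero_off_countable hk.countable htc htd x 0, hteq x hx]
  ring

/-- The factor `k` in the density suppresses the logarithm, so the time function is a continuous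
primitive of `w` and no regularization remains. -/
theorem principalValue_mul_self (hk : SimpleZeros k)
    (hkp : Function.Periodic k (2 * Real.pi)) {w : ℝ → ℝ} (hw : ContDiff ℝ ∞ w)
    (hwp : Function.Periodic w (2 * Real.pi)) :
    principalValue k (fun x => k x * w x) = ∫ x in (0 : ℝ)..2 * Real.pi, w x := by
  have ha : ContDiff ℝ ∞ fun x => k x * w x := hk.smooth.mul hw
  have hc : Continuous (timeFn k fun x => k x * w x) := by
    refine (hk.continuous_integral_regDensity ha).add (hk.continuous_mul_log
      ((hk.weight_smooth ha).differentiable (by simp)) fun x hx => by simp [hx])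
  have h := MeasureTheory.integral_eq_of_hasDerivAt_off_countable
    (timeFn k fun x => k x * w x) w (a := 0) (b := 2 * Real.pi) hk.countable hc.continuousOn
    (fun x hx => by
      have hx : k x ≠ 0 := hx.2
      have := hk.hasDerivAt_timeFn ha hx
      rwa [mul_div_cancel_left₀ _ hx] at this)
    (hw.continuous.intervalIntegrable _ _)
  have h2 := hk.timeFn_add_period ha hkp (hkp.mul hwp) 0
  rw [zero_add] at h2
  rw [h, h2]
  ring

end SimpleZeros

/-! ### Ordinary differential equations on the line with periodic coefficients -/

theorem exists_lipschitzWith_of_periodic {h : ℝ → ℝ} {T : ℝ} (hh : ContDiff ℝ ∞ h) (hT : 0 < T)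
    (hp : Function.Periodic h T) : ∃ K, LipschitzWith K h := by
  have hd := deriv_periodic hp
  obtain ⟨M, hM⟩ := isBounded_iff_forall_norm_le.1
    (hd.isBounded_of_continuous hT.ne' (hh.continuous_deriv (by simp)))
  refine ⟨M.toNNReal, lipschitzWith_of_nnnorm_deriv_le (hh.differentiable (by simp)) fun x => ?_⟩
  rw [← NNReal.coe_le_coe, coe_nnnorm]
  exact (hM _ (mem_range_self x)).trans (Real.le_coe_toNNReal M)

theorem ode_unique_of_periodic {h : ℝ → ℝ} {T : ℝ} (hh : ContDiff ℝ ∞ h) (hT : 0 < T)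
    (hp : Function.Periodic h T) {C D : ℝ → ℝ} (hC : ∀ s, HasDerivAt C (h (C s)) s)
    (hD : ∀ s, HasDerivAt D (h (D s)) s) {s₀ : ℝ} (h0 : C s₀ = D s₀) : C = D := by
  obtain ⟨K, hK⟩ := exists_lipschitzWith_of_periodic hh hT hp
  exact ODE_solution_unique_univ (v := fun _ => h) (s := fun _ => univ) (K := K)
    (fun _ => hK.lipschitzOnWith) (fun t => ⟨hC t, mem_univ _⟩) (fun t => ⟨hD t, mem_univ _⟩) h0

/-- Periodicity bounds `h` and its Lipschitz constant globally, so local solutions exist on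
intervals of uniform length and can be continued to all times. -/
theorem exists_ode_solution_of_periodic {h : ℝ → ℝ} {T : ℝ} (hh : ContDiff ℝ ∞ h) (hT : 0 < T)
    (hp : Function.Periodic h T) (x₀ : ℝ) :
    ∃ C : ℝ → ℝ, C 0 = x₀ ∧ ∀ s, HasDerivAt C (h (C s)) s := by
  obtain ⟨K, hK⟩ := exists_lipschitzWith_of_periodic hh hT hp
  obtain ⟨M, hM⟩ := isBounded_iff_forall_norm_le.1
    (hp.isBounded_of_continuous hT.ne' hh.continuous)
  have hloc : ∀ x : ℝ, ∃ γ : ℝ → ℝ, γ 0 = x ∧ ∀ t ∈ Ioo (-1 : ℝ) 1, HasDerivAt γ (h (γ t)) t := by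
    intro x
    -- Radius `M` is enough: a solution of speed at most `M` moves by at most `M` in unit time.
    have hPL : IsPicardLindelof (fun _ => h) (tmin := -1) (tmax := 1) ⟨0, by norm_num⟩ x
        M.toNNReal 0 M.toNNReal K :=
      { lipschitzOnWith := fun _ _ => hK.lipschitzOnWith
        continuousOn := fun _ _ => continuousOn_const
        norm_le := fun _ _ y _ => (hM _ (mem_range_self y)).trans (Real.le_coe_toNNReal M)
        mul_max_le := by simp }
    obtain ⟨α, h0, hα⟩ := hPL.exists_eq_forall_mem_Icc_hasDerivWithinAt₀
    exact ⟨α, h0, fun t ht => (hα t (Ioo_subset_Icc_self ht)).hasDerivAt (Icc_mem_nhds ht.1 ht.2)⟩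
  let v : (x : ℝ) → TangentSpace 𝓘(ℝ, ℝ) x := fun x => h x
  have hv : ContMDiff 𝓘(ℝ, ℝ) 𝓘(ℝ, ℝ).tangent 1
      (fun x => (⟨x, v x⟩ : TangentBundle 𝓘(ℝ, ℝ) ℝ)) := by
    rw [contMDiff_vectorSpace_iff_contDiff]
    exact hh.of_le (by simp)
  obtain ⟨C, hC0, hC⟩ := exists_isMIntegralCurve_of_isMIntegralCurveOn (I := 𝓘(ℝ, ℝ)) hv one_pos
    (fun x => by
      obtain ⟨γ, h0, hγ⟩ := hloc x
      refine ⟨γ, h0, fun t ht => ?_⟩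
      have h := hasDerivAt_iff_hasFDerivAt.1 (hγ t ht)
      exact h.hasMFDerivAt.hasMFDerivWithinAt) x₀
  refine ⟨C, hC0, fun s => hasDerivAt_iff_hasFDerivAt.2 ?_⟩
  exact hasMFDerivAt_iff_hasFDerivAt.1 (hC s)

namespace SimpleZeros

variable {k a : ℝ → ℝ}

/-- An increasing map that permutes the zeros of `k` and fixes the end points of a bounded
interval fixes the zeros of `k` in this interval. -/
theorem map_eq_self (hk : SimpleZeros k) {Φ : ℝ → ℝ} (hΦ : StrictMono Φ)
    (hz : ∀ x, k x = 0 → k (Φ x) = 0) {l u q : ℝ} (hl : Φ l = l) (hu : Φ u = u)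
    (hq : q ∈ Icc l u) (hq0 : k q = 0) : Φ q = q := by
  have hmem : ∀ n, Φ^[n] q ∈ Icc l u ∩ {x | k x = 0} := by
    intro n
    induction n with
    | zero => exact ⟨hq, hq0⟩
    | succ n ih =>
      rw [Function.iterate_succ_apply']
      exact ⟨⟨hl ▸ hΦ.monotone ih.1.1, hu ▸ hΦ.monotone ih.1.2⟩, hz _ ih.2⟩
  -- If `q` moved, its orbit would be strictly monotone, giving infinitely many zeros in a compact
  -- interval.
  have hno : ¬ Function.Injective fun n => Φ^[n] q := fun hi =>
    infinite_of_injective_forall_mem hi hmem (hk.finite_Icc l u)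
  rcases lt_trichotomy (Φ q) q with h | h | h
  · exact absurd (hΦ.strictAnti_iterate_of_map_lt h).injective hno
  · exact h
  · exact absurd (hΦ.strictMono_iterate_of_lt_map h).injective hno

/-- An increasing map cannot carry a point past a fixed point, so `x` and `Φ x` lie in the same
interval between zeros. -/
theorem ne_zero_of_mem_uIcc_map {Φ : ℝ → ℝ} (hΦ : StrictMono Φ)
    (hfix : ∀ x, k x = 0 → Φ x = x) {x : ℝ} (hx : k x ≠ 0) {y : ℝ} (hy : y ∈ uIcc (Φ x) x) :
    k y ≠ 0 := by
  intro hy0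
  have hyx : y ≠ x := fun h => hx (h ▸ hy0)
  have hf := hfix y hy0
  rcases mem_uIcc.1 hy with h | h
  · have := hΦ (lt_of_le_of_ne h.2 hyx)
    linarith [h.1]
  · have := hΦ (lt_of_le_of_ne h.1 hyx.symm)
    linarith [h.2]

theorem timeFn_injOn (hk : SimpleZeros k) (ha : ContDiff ℝ ∞ a) (hpos : ∀ x, 0 < a x) {x y : ℝ}
    (hxy : ∀ z ∈ uIcc x y, k z ≠ 0) (h : timeFn k a x = timeFn k a y) : x = y := by
  by_contra hne
  wlog hlt : x < y generalizing x y
  · exact this (by rwa [uIcc_comm]) h.symm (Ne.symm hne)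
      (lt_of_le_of_ne (not_lt.1 hlt) (Ne.symm hne))
  rw [uIcc_of_le hlt.le] at hxy
  obtain ⟨z, hz, hz0⟩ := exists_hasDerivAt_eq_zero hlt
    (fun z hz => (hk.hasDerivAt_timeFn ha (hxy z hz)).continuousAt.continuousWithinAt) h
    (fun z hz => hk.hasDerivAt_timeFn ha (hxy z (Ioo_subset_Icc_self hz)))
  exact div_ne_zero (hpos z).ne' (hxy z (Ioo_subset_Icc_self hz)) hz0

theorem eq_const_of_zero (hk : SimpleZeros k) (ha : ContDiff ℝ ∞ a) (hpos : ∀ x, 0 < a x)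
    {T : ℝ} (hT : 0 < T) (hkp : Function.Periodic k T) (hap : Function.Periodic a T)
    {C : ℝ → ℝ} (hC : ∀ s, HasDerivAt C (k (C s) / a (C s)) s) {s₁ : ℝ} (hs₁ : k (C s₁) = 0) :
    C = fun _ => C s₁ :=
  ode_unique_of_periodic (h := fun x => k x / a x) (hk.smooth.div ha fun x => (hpos x).ne') hT
    (hkp.div hap) hC (fun s => by simpa [hs₁] using hasDerivAt_const s (C s₁)) (s₀ := s₁) rfl

/-- A transformation that preserves the vector field `k / a` and fixes its zeros is a flow map. -/
theorem exists_flow_time (hk : SimpleZeros k) (ha : ContDiff ℝ ∞ a) (hpos : ∀ x, 0 < a x)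
    {T : ℝ} (hT : 0 < T) (hkp : Function.Periodic k T) (hap : Function.Periodic a T)
    {Φ : ℝ → ℝ} (hΦ : ContDiff ℝ ∞ Φ) (hΦ0 : ∀ x, 0 < deriv Φ x)
    (hconj : ∀ x, k (Φ x) * a x = deriv Φ x * k x * a (Φ x))
    (hfix : ∀ x, k x = 0 → Φ x = x) :
    ∃ t₀, ∀ C : ℝ → ℝ, (∀ s, HasDerivAt C (k (C s) / a (C s)) s) →
      ∀ s, Φ (C s) = C (s + t₀) := by
  have hmono : StrictMono Φ := strictMono_of_deriv_pos hΦ0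
  obtain ⟨t₀, ht₀⟩ := hk.exists_timeFn_comp ha hpos hΦ (fun x => (hΦ0 x).ne') hconj
  refine ⟨t₀, fun C hC s => ?_⟩
  have hCc : Continuous C := continuous_iff_continuousAt.2 fun s => (hC s).continuousAt
  by_cases hcrit : ∃ s₁, k (C s₁) = 0
  · obtain ⟨s₁, hs₁⟩ := hcrit
    rw [hk.eq_const_of_zero ha hpos hT hkp hap hC hs₁]
    exact hfix _ hs₁
  · push Not at hcrit
    -- Along an integral curve the time function advances at unit speed.
    have hd : ∀ s, HasDerivAt (fun s => timeFn k a (C s) - s) 0 s := fun s => by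
      have h := ((hk.hasDerivAt_timeFn ha (hcrit s)).comp s (hC s)).sub (hasDerivAt_id s)
      refine h.congr_deriv ?_
      have h1 := (hpos (C s)).ne'
      have h2 := hcrit s
      field_simp
      ring
    have hA := is_const_of_deriv_eq_zero (fun s => (hd s).differentiableAt)
      (fun s => (hd s).deriv) (s + t₀) s
    have hA' : timeFn k a (C (s + t₀)) = timeFn k a (C s) + t₀ := by
      linarith
    -- The two points have equal time; injectivity needs them in one interval between zeros, so both
    -- are joined to `C s`.
    refine hk.timeFn_injOn ha hpos (fun z hz => ?_) ((ht₀ _ (hcrit s)).trans hA'.symm)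
    rcases uIcc_subset_uIcc_union_uIcc (b := C s) hz with h | h
    · exact ne_zero_of_mem_uIcc_map hmono hfix (hcrit s) h
    · obtain ⟨σ, -, rfl⟩ := intermediate_value_uIcc hCc.continuousOn h
      exact hcrit σ

/-- The principal value is multiplied by the degree of a transformation that preserves the vector
field. -/
theorem mul_principalValue (hk : SimpleZeros k) (ha : ContDiff ℝ ∞ a) (hpos : ∀ x, 0 < a x)
    (hkp : Function.Periodic k (2 * Real.pi)) (hap : Function.Periodic a (2 * Real.pi))
    {Φ : ℝ → ℝ} (hΦ : ContDiff ℝ ∞ Φ) (hΦ0 : ∀ x, deriv Φ x ≠ 0)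
    (hconj : ∀ x, k (Φ x) * a x = deriv Φ x * k x * a (Φ x)) {n : ℤ}
    (hn : ∀ x, Φ (x + 2 * Real.pi) = Φ x + n * (2 * Real.pi)) :
    n * principalValue k a = principalValue k a := by
  obtain ⟨t₀, ht₀⟩ := hk.exists_timeFn_comp ha hpos hΦ hΦ0 hconj
  obtain ⟨x, hx⟩ := (hk.eventually_ne 0).exists
  -- Compare the same shift `t₀` at `x` and at `x + 2π`: one side gains `n` principal values, the
  -- other gains one.
  have h1 := ht₀ x hx
  have h2 := ht₀ (x + 2 * Real.pi) (by rwa [hkp x])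
  rw [hn, hk.timeFn_add_zsmul ha hkp hap, hk.timeFn_add_period ha hkp hap] at h2
  linarith

end SimpleZeros

/-! ### The angular coordinate -/

attribute [local instance] finrank_real_complex_fact'

theorem contMDiff_coe_circle : ContMDiff (𝓡 1) 𝓘(ℝ, ℂ) ∞ fun z : Circle => (z : ℂ) :=
  contMDiff_coe_sphere

theorem contDiffAt_complex_arg {z : ℂ} (hz : z ∈ Complex.slitPlane) :
    ContDiffAt ℝ ∞ Complex.arg z := by
  have h : ContDiffAt ℝ ∞ (fun w => (Complex.log w).im) z :=
    Complex.imCLM.contDiff.contDiffAt.comp z ((Complex.contDiffAt_log hz).restrict_scalars ℝ)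
  simpa only [Complex.log_im] using h

/-- Rotating the base point to `1` keeps `arg` off its branch cut. This local formula for `C` in
terms of `exp ∘ C` transfers regularity from the circle to the lift. -/
theorem eventually_eq_arg {C : ℝ → ℝ} {t₀ : ℝ} (hC : ContinuousAt C t₀) :
    C =ᶠ[𝓝 t₀] fun t =>
      C t₀ + Complex.arg ((Circle.exp (C t) : ℂ) * ((Circle.exp (C t₀))⁻¹ : Circle)) := by
  have h : ∀ᶠ t in 𝓝 t₀, C t - C t₀ ∈ Ioo (-Real.pi) Real.pi :=
    (hC.sub continuousAt_const).eventually_mem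
      (by simpa using Ioo_mem_nhds (neg_lt_zero.2 Real.pi_pos) Real.pi_pos)
  filter_upwards [h] with t ht
  rw [← Circle.coe_mul, ← Circle.exp_neg, ← Circle.exp_add, ← sub_eq_add_neg,
    Circle.arg_exp ht.1 ht.2.le]
  ring

theorem contDiffAt_arg_mul (θ₀ : ℝ) :
    ContDiffAt ℝ ∞ (fun w : ℂ => Complex.arg (w * ((Circle.exp θ₀)⁻¹ : Circle)))
      (Circle.exp θ₀) := by
  refine ContDiffAt.comp (Circle.exp θ₀ : ℂ) (contDiffAt_complex_arg ?_)
    (contDiffAt_id.mul contDiffAt_const)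
  have h : (Circle.exp θ₀ : ℂ) * ((Circle.exp θ₀)⁻¹ : Circle) = 1 := by
    rw [← Circle.coe_mul, mul_inv_cancel, Circle.coe_one]
  exact h ▸ Complex.one_mem_slitPlane

theorem contDiffAt_of_exp {C : ℝ → ℝ} {t₀ : ℝ} (hC : ContinuousAt C t₀)
    (h : ContMDiffAt 𝓘(ℝ, ℝ) (𝓡 1) ∞ (fun t => Circle.exp (C t)) t₀) : ContDiffAt ℝ ∞ C t₀ := by
  have h1 : ContDiffAt ℝ ∞ (fun t => (Circle.exp (C t) : ℂ)) t₀ :=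
    ((contMDiff_coe_circle _).comp t₀ h).contDiffAt
  have h2 := (contDiffAt_const (c := C t₀)).add ((contDiffAt_arg_mul (C t₀)).comp t₀ h1)
  exact h2.congr_of_eventuallyEq (eventually_eq_arg hC)

theorem differentiableAt_of_exp {C : ℝ → ℝ} {t₀ : ℝ} (hC : ContinuousAt C t₀)
    (h : MDifferentiableAt 𝓘(ℝ, ℝ) (𝓡 1) (fun t => Circle.exp (C t)) t₀) :
    DifferentiableAt ℝ C t₀ := by
  have h1 : DifferentiableAt ℝ (fun t => (Circle.exp (C t) : ℂ)) t₀ :=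
    (((contMDiff_coe_circle.mdifferentiable (by simp)) _).comp t₀ h).differentiableAt
  have h2 := (((contDiffAt_arg_mul (C t₀)).differentiableAt (by simp)).comp t₀ h1).const_add (C t₀)
  exact h2.congr_of_eventuallyEq (eventually_eq_arg hC)

theorem exists_contMDiff_of_periodic {G : ℝ → ℝ} (hG : ContDiff ℝ ∞ G)
    (hp : Function.Periodic G (2 * Real.pi)) :
    ∃ η : Circle → ℝ, ContMDiff (𝓡 1) 𝓘(ℝ, ℝ) ∞ η ∧ ∀ θ, η (Circle.exp θ) = G θ := by
  have hexp : ∀ x y, Circle.exp x = Circle.exp y → G x = G y := by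
    intro x y h
    obtain ⟨m, rfl⟩ := Circle.exp_eq_exp.1 h
    exact (hp.int_mul m) y
  refine ⟨fun z => G (Complex.arg z), fun z => ?_, fun θ => hexp _ _ (Circle.exp_arg _)⟩
  obtain ⟨θ₀, rfl⟩ := Circle.exp_surjective z
  -- Periodicity of `G` allows the branch cut of `arg` to be moved away from the point under
  -- consideration.
  have heq : (fun z : Circle => G (Complex.arg z)) = fun z : Circle =>
      G (θ₀ + Complex.arg ((z : ℂ) * ((Circle.exp θ₀)⁻¹ : Circle))) := by
    funext z
    refine hexp _ _ ?_
    rw [Circle.exp_add, ← Circle.coe_mul, Circle.exp_arg, Circle.exp_arg]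
    simp
  rw [heq]
  have h1 : ContDiffAt ℝ ∞ (fun w : ℂ =>
      G (θ₀ + Complex.arg (w * ((Circle.exp θ₀)⁻¹ : Circle)))) (Circle.exp θ₀) :=
    hG.contDiffAt.comp _ (contDiffAt_const.add (contDiffAt_arg_mul θ₀))
  exact h1.contMDiffAt.comp _ (contMDiff_coe_circle _)

theorem exists_continuous_lift {c : ℝ → Circle} (hc : Continuous c) {t₀ x₀ : ℝ}
    (h : Circle.exp x₀ = c t₀) :
    ∃ C : ℝ → ℝ, Continuous C ∧ C t₀ = x₀ ∧ ∀ t, Circle.exp (C t) = c t := by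
  obtain ⟨C, ⟨h0, hC⟩, -⟩ :=
    Circle.isCoveringMap_exp.existsUnique_continuousMap_lifts ⟨c, hc⟩ t₀ x₀ h
  exact ⟨C, C.continuous, h0, fun t => congrFun hC t⟩

theorem eq_add_of_exp_eq {C D : ℝ → ℝ} (hC : Continuous C) (hD : Continuous D)
    (h : ∀ t, Circle.exp (C t) = Circle.exp (D t)) :
    ∃ n : ℤ, ∀ t, C t = D t + n * (2 * Real.pi) := by
  obtain ⟨n, hn⟩ := Circle.exp_eq_exp.1 (h 0)
  refine ⟨n, fun t => ?_⟩
  have := Circle.isCoveringMap_exp.eq_of_comp_eq (g₁ := C) (g₂ := fun t => D t + n * (2 * Real.pi))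
    hC (by fun_prop) (funext fun t => ?_) 0 hn
  · exact congrFun this t
  · simp only [Function.comp_apply, h t]
    exact Circle.exp_eq_exp.2 ⟨-n, by push_cast; ring⟩

/-! ### Lifts, orientation and degree -/

/-- A smooth map of the line that covers a map of the circle. -/
structure IsLift (φ : Circle → Circle) (Φ : ℝ → ℝ) : Prop where
  smooth : ContDiff ℝ ∞ Φ
  exp_apply : ∀ θ, Circle.exp (Φ θ) = φ (Circle.exp θ)

theorem exists_isLift {φ : Circle → Circle} (hφ : ContMDiff (𝓡 1) (𝓡 1) ∞ φ) {θ₀ x₀ : ℝ}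
    (h : Circle.exp x₀ = φ (Circle.exp θ₀)) : ∃ Φ, IsLift φ Φ ∧ Φ θ₀ = x₀ := by
  have hs : ContMDiff 𝓘(ℝ, ℝ) (𝓡 1) ∞ fun θ => φ (Circle.exp θ) := hφ.comp contMDiff_circleExp
  obtain ⟨Φ, hc, h0, hΦ⟩ := exists_continuous_lift hs.continuous h
  refine ⟨Φ, ⟨contDiff_iff_contDiffAt.2 fun θ => contDiffAt_of_exp hc.continuousAt ?_, hΦ⟩, h0⟩
  simp only [hΦ]
  exact hs θ

namespace IsLift

variable {φ ψ : Circle → Circle} {Φ Ψ : ℝ → ℝ}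

theorem hasDerivAt (h : IsLift φ Φ) (x : ℝ) : HasDerivAt Φ (deriv Φ x) x :=
  (h.smooth.differentiable (by simp) x).hasDerivAt

theorem comp (h : IsLift φ Φ) (h' : IsLift ψ Ψ) : IsLift (φ ∘ ψ) (Φ ∘ Ψ) :=
  ⟨h.smooth.comp h'.smooth, fun θ => by
    simp only [Function.comp_apply, h.exp_apply, h'.exp_apply]⟩

theorem exists_eq_add (h : IsLift φ Φ) (h' : IsLift φ Ψ) :
    ∃ n : ℤ, ∀ t, Φ t = Ψ t + n * (2 * Real.pi) :=
  eq_add_of_exp_eq h.smooth.continuous h'.smooth.continuous fun t => by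
    rw [h.exp_apply, h'.exp_apply]

theorem deriv_eq (h : IsLift φ Φ) (h' : IsLift φ Ψ) : deriv Φ = deriv Ψ := by
  obtain ⟨n, hn⟩ := h.exists_eq_add h'
  rw [funext hn]
  funext x
  exact deriv_add_const _

theorem exists_degree (h : IsLift φ Φ) :
    ∃ n : ℤ, ∀ x, Φ (x + 2 * Real.pi) = Φ x + n * (2 * Real.pi) :=
  eq_add_of_exp_eq (C := fun x => Φ (x + 2 * Real.pi)) (h.smooth.continuous.comp (by fun_prop))
    h.smooth.continuous fun t => by
    rw [h.exp_apply, h.exp_apply, Circle.exp_add_two_pi]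

/-- Composition with a lift of `φ⁻¹` is a lift of the identity, which differs from `id` by a
constant and so has derivative `1`. -/
theorem deriv_ne_zero {φ : Diff} (h : IsLift φ Φ) (x : ℝ) : deriv Φ x ≠ 0 := by
  obtain ⟨Ψ, hΨ, -⟩ := exists_isLift (φ := (φ⁻¹ : Diff)) (φ⁻¹ : Diff).contMDiff
    (Circle.exp_arg ((φ⁻¹ : Diff) (Circle.exp 0)))
  have h1 : IsLift id (Ψ ∘ Φ) := by
    have := hΨ.comp h
    rwa [show ((φ⁻¹ : Diff) : Circle → Circle) ∘ φ = id from funext (inv_apply_self φ)] at this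
  have h2 : IsLift id (id : ℝ → ℝ) := ⟨contDiff_id, fun _ => rfl⟩
  have h3 := congrFun (h1.deriv_eq h2) x
  rw [((hΨ.hasDerivAt (Φ x)).comp x (h.hasDerivAt x)).deriv, deriv_id] at h3
  exact right_ne_zero_of_mul (h3 ▸ one_ne_zero)

end IsLift

/-- A map of the circle with an increasing lift. -/
def Preserving (φ : Circle → Circle) : Prop := ∃ Φ, IsLift φ Φ ∧ ∀ x, 0 < deriv Φ x

/-- A map of the circle with a decreasing lift. -/
def Reversing (φ : Circle → Circle) : Prop := ∃ Φ, IsLift φ Φ ∧ ∀ x, deriv Φ x < 0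

/-- By Darboux's theorem a derivative that never vanishes has constant sign. -/
theorem preserving_or_reversing (φ : Diff) : Preserving φ ∨ Reversing φ := by
  obtain ⟨Φ, hΦ, -⟩ := exists_isLift φ.contMDiff (Circle.exp_arg (φ (Circle.exp 0)))
  have := hasDerivWithinAt_forall_lt_or_forall_gt_of_forall_ne (s := univ) (m := 0) convex_univ
    (fun x _ => (hΦ.hasDerivAt x).hasDerivWithinAt) (fun x _ => hΦ.deriv_ne_zero x)
  rcases this with h | h
  · exact Or.inr ⟨Φ, hΦ, fun x => h x (mem_univ x)⟩
  · exact Or.inl ⟨Φ, hΦ, fun x => h x (mem_univ x)⟩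

theorem Preserving.comp {φ ψ : Circle → Circle} (hφ : Preserving φ) (hψ : Preserving ψ) :
    Preserving (φ ∘ ψ) := by
  obtain ⟨Φ, hΦ, h1⟩ := hφ
  obtain ⟨Ψ, hΨ, h2⟩ := hψ
  refine ⟨_, hΦ.comp hΨ, fun x => ?_⟩
  rw [((hΦ.hasDerivAt _).comp x (hΨ.hasDerivAt x)).deriv]
  exact mul_pos (h1 _) (h2 _)

theorem Reversing.comp {φ ψ : Circle → Circle} (hφ : Reversing φ) (hψ : Reversing ψ) :
    Preserving (φ ∘ ψ) := by
  obtain ⟨Φ, hΦ, h1⟩ := hφ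
  obtain ⟨Ψ, hΨ, h2⟩ := hψ
  refine ⟨_, hΦ.comp hΨ, fun x => ?_⟩
  rw [((hΦ.hasDerivAt _).comp x (hΨ.hasDerivAt x)).deriv]
  exact mul_pos_of_neg_of_neg (h1 _) (h2 _)

theorem Reversing.not_preserving {φ : Circle → Circle} (hφ : Reversing φ) : ¬ Preserving φ := by
  rintro ⟨Ψ, hΨ, h2⟩
  obtain ⟨Φ, hΦ, h1⟩ := hφ
  have := h2 0
  rw [← hΦ.deriv_eq hΨ] at this
  exact lt_asymm this (h1 0)

theorem Reversing.preserving_comp {φ ψ : Diff} (hφ : Reversing φ) (hψ : Preserving ψ) :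
    Reversing (φ * ψ : Diff) := by
  obtain ⟨Φ, hΦ, h1⟩ := hφ
  obtain ⟨Ψ, hΨ, h2⟩ := hψ
  refine ⟨_, hΦ.comp hΨ, fun x => ?_⟩
  rw [((hΦ.hasDerivAt _).comp x (hΨ.hasDerivAt x)).deriv]
  exact mul_neg_of_neg_of_pos (h1 _) (h2 _)

/-- A reversing map has a fixed point. -/
theorem Reversing.exists_fixed {φ : Circle → Circle} (hφ : Reversing φ) :
    ∃ Φ p, IsLift φ Φ ∧ (∀ x, deriv Φ x < 0) ∧ φ (Circle.exp p) = Circle.exp p ∧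
      ∃ n : ℤ, Φ p = p + n * (2 * Real.pi) := by
  obtain ⟨Φ, hΦ, h1⟩ := hφ
  have hpi := Real.two_pi_pos
  set δ : ℝ → ℝ := fun x => Φ x - x with hδ
  have hδc : Continuous δ := hΦ.smooth.continuous.sub continuous_id
  have hanti : StrictAnti Φ := strictAnti_of_deriv_neg h1
  have hlt : δ (2 * Real.pi) ≤ δ 0 - 2 * Real.pi := by
    have := hanti hpi
    simp only [hδ]
    linarith
  -- Since `δ` drops by at least `2π` over a period, it attains the largest multiple of `2π` not
  -- exceeding `δ 0`.
  set n : ℤ := ⌊δ 0 / (2 * Real.pi)⌋ with hn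
  have hn1 : n * (2 * Real.pi) ≤ δ 0 := by
    rw [← le_div_iff₀ hpi]
    exact Int.floor_le _
  have hn2 : δ 0 < (n + 1) * (2 * Real.pi) := by
    rw [← div_lt_iff₀ hpi]
    exact Int.lt_floor_add_one _
  obtain ⟨p, -, hp⟩ := intermediate_value_Icc' hpi.le hδc.continuousOn
    (show (n : ℝ) * (2 * Real.pi) ∈ Icc (δ (2 * Real.pi)) (δ 0) from ⟨by linarith, hn1⟩)
  have hp' : Φ p = p + n * (2 * Real.pi) := by
    simp only [hδ] at hp
    linarith
  refine ⟨Φ, p, hΦ, h1, ?_, n, hp'⟩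
  rw [← hΦ.exp_apply]
  exact Circle.exp_eq_exp.2 ⟨n, hp'⟩

theorem Reversing.degree_neg {φ : Circle → Circle} {Φ : ℝ → ℝ} (_ : IsLift φ Φ)
    (h : ∀ x, deriv Φ x < 0) {n : ℤ} (hn : ∀ x, Φ (x + 2 * Real.pi) = Φ x + n * (2 * Real.pi)) :
    n < 0 := by
  have h1 := (strictAnti_of_deriv_neg h) Real.two_pi_pos
  have h2 := hn 0
  rw [zero_add] at h2
  have : (n : ℝ) * (2 * Real.pi) < 0 := by linarith
  exact_mod_cast neg_of_mul_neg_left this Real.two_pi_pos.le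

/-- An increasing lift of a diffeomorphism has degree one. -/
theorem IsLift.degree_one {φ : Diff} {Φ : ℝ → ℝ} (hΦ : IsLift φ Φ) (h : ∀ x, 0 < deriv Φ x)
    (x : ℝ) : Φ (x + 2 * Real.pi) = Φ x + 2 * Real.pi := by
  have hpi := Real.two_pi_pos
  obtain ⟨n, hn⟩ := hΦ.exists_degree
  have hmono := strictMono_of_deriv_pos h
  have hn0 : 0 < n := by
    have h1 := hmono (show x < x + 2 * Real.pi by linarith)
    rw [hn] at h1
    have : 0 < (n : ℝ) * (2 * Real.pi) := by linarith
    exact_mod_cast pos_of_mul_pos_left this hpi.le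
  by_contra hne
  have hn1 : n ≠ 1 := fun h1 => hne (by rw [hn, h1]; simp)
  have hn2 : (2 : ℝ) ≤ n := by exact_mod_cast (show (2 : ℤ) ≤ n by omega)
  -- With degree at least `2`, the value `Φ x + 2π` is already attained strictly inside the period,
  -- against injectivity of `φ`.
  obtain ⟨y, hy, hy'⟩ := intermediate_value_Ioo (show x ≤ x + 2 * Real.pi by linarith)
    hΦ.smooth.continuous.continuousOn
    (show Φ x + 2 * Real.pi ∈ Ioo (Φ x) (Φ (x + 2 * Real.pi)) from
      ⟨by linarith, by rw [hn]; nlinarith⟩)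
  have h3 : φ (Circle.exp y) = φ (Circle.exp x) := by
    rw [← hΦ.exp_apply, ← hΦ.exp_apply, hy', Circle.exp_add_two_pi]
  obtain ⟨m, hm⟩ := Circle.exp_eq_exp.1 (φ.injective h3)
  have h4 : 0 < (m : ℝ) := by
    refine pos_of_mul_pos_left ?_ hpi.le
    linarith [hy.1]
  have h5 : (m : ℝ) < 1 := by
    have := hy.2
    rw [hm] at this
    nlinarith
  have h6 : 0 < m := by exact_mod_cast h4
  have h7 : m < 1 := by exact_mod_cast h5
  omega

/-! ### Tangent vectors of the circle in the angular coordinate -/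

theorem hasMFDerivAt_exp (θ : ℝ) : HasMFDerivAt 𝓘(ℝ, ℝ) (𝓡 1) (fun t : ℝ => Circle.exp t) θ
    (mfderiv 𝓘(ℝ, ℝ) (𝓡 1) (fun t : ℝ => Circle.exp t) θ) :=
  (contMDiff_circleExp.mdifferentiable (one_ne_zero) θ).hasMFDerivAt

theorem hasMFDerivAt_exp_comp {C : ℝ → ℝ} {t C' : ℝ} (hC : HasDerivAt C C' t) :
    HasMFDerivAt 𝓘(ℝ, ℝ) (𝓡 1) (fun t => Circle.exp (C t)) t
      ((1 : ℝ →L[ℝ] ℝ).smulRight (C' • angleVector (C t))) := by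
  have h1 := (hasMFDerivAt_exp (C t)).comp t hC.hasFDerivAt.hasMFDerivAt
  refine h1.congr_mfderiv ?_
  ext1
  let L : ℝ →L[ℝ] EuclideanSpace ℝ (Fin 1) :=
    mfderiv 𝓘(ℝ, ℝ) (𝓡 1) (fun t : ℝ => Circle.exp t) (C t)
  have h2 : L ((1 : ℝ) • C') = (1 : ℝ) • C' • L 1 := by
    rw [map_smul, ← map_smul L C', smul_eq_mul, mul_one]
  exact h2

theorem angleVector_ne_zero (θ : ℝ) : angleVector θ ≠ 0 := by
  intro h
  have h1 := ((contMDiff_coe_circle.mdifferentiable (by simp)) (Circle.exp θ)).hasMFDerivAt.comp θ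
    (hasMFDerivAt_exp θ)
  have h2 : HasDerivAt (fun t : ℝ => (Circle.exp t : ℂ)) (Circle.exp θ * Complex.I) θ := by
    have h3 : HasDerivAt (fun t : ℝ => Complex.exp (t * Complex.I))
        (Complex.exp (θ * Complex.I) * (1 * Complex.I)) θ :=
      (Complex.ofRealCLM.hasDerivAt.mul_const Complex.I).cexp
    simpa [Circle.coe_exp] using h3
  have h4 := h1.mfderiv.symm.trans h2.hasFDerivAt.hasMFDerivAt.mfderiv
  have h5 := DFunLike.congr_fun h4 (1 : ℝ)
  have h6 : mfderiv 𝓘(ℝ, ℝ) (𝓡 1) (fun t : ℝ => Circle.exp t) θ (1 : ℝ) = 0 := h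
  have h7 : (Circle.exp θ : ℂ) * Complex.I = 0 := by
    have h8 : mfderiv (𝓡 1) 𝓘(ℝ, ℂ) (fun z : Circle => (z : ℂ)) (Circle.exp θ)
      (mfderiv 𝓘(ℝ, ℝ) (𝓡 1) (fun t : ℝ => Circle.exp t) θ (1 : ℝ)) =
        (1 : ℝ) • ((Circle.exp θ : ℂ) * Complex.I) := h5
    rw [h6, map_zero, one_smul] at h8
    exact h8.symm
  exact mul_ne_zero (Circle.coe_ne_zero _) Complex.I_ne_zero h7

/-- The coordinate vector field `∂_θ`. -/
noncomputable def angleField : VField := fun z =>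
  (show EuclideanSpace ℝ (Fin 1) from angleVector (Complex.arg z))

/-- The map `exp` is unchanged by translation by `θ' - θ`. The comparison takes place in the model
space because the two tangent spaces are different types. -/
theorem angleVector_congr {θ θ' : ℝ} (h : Circle.exp θ = Circle.exp θ') :
    (show EuclideanSpace ℝ (Fin 1) from angleVector θ) = angleVector θ' := by
  have h1 : HasDerivAt (fun t => t + (θ' - θ)) 1 θ := (hasDerivAt_id θ).add_const _
  have h2 := hasMFDerivAt_exp_comp h1
  have h3 : (fun t => Circle.exp (t + (θ' - θ))) = fun t => Circle.exp t := by
    funext t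
    rw [Circle.exp_add, Circle.exp_sub, h, div_self', mul_one]
  rw [h3] at h2
  have h4 := DFunLike.congr_fun (hasMFDerivAt_unique (hasMFDerivAt_exp θ) h2) (1 : ℝ)
  have h5 : (show EuclideanSpace ℝ (Fin 1) from angleVector θ) =
      (1 : ℝ) • (1 : ℝ) • (show EuclideanSpace ℝ (Fin 1) from angleVector (θ + (θ' - θ))) := h4
  rw [h5, one_smul, one_smul, add_sub_cancel]

theorem angleField_exp (θ : ℝ) : angleField (Circle.exp θ) = angleVector θ :=
  angleVector_congr (Circle.exp_arg _)

theorem angleField_ne_zero (z : Circle) : angleField z ≠ 0 := angleVector_ne_zero _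

theorem exists_eq_smul_angleField (z : Circle) (v : TangentSpace (𝓡 1) z) :
    ∃ c : ℝ, v = c • angleField z := by
  have h1 : Module.finrank ℝ (EuclideanSpace ℝ (Fin 1)) = 1 := by simp
  obtain ⟨c, hc⟩ := exists_smul_eq_of_finrank_eq_one h1
    (x := (show EuclideanSpace ℝ (Fin 1) from angleField z)) (angleField_ne_zero z) v
  exact ⟨c, hc.symm⟩

theorem smul_angleField_injective {z : Circle} {c d : ℝ}
    (h : c • angleField z = d • angleField z) : c = d :=
  smul_left_injective ℝ (angleField_ne_zero z) h

theorem hasMFDerivAt_of_exp {c : ℝ → Circle} {C : ℝ → ℝ} {t C' : ℝ}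
    (hc : ∀ t, Circle.exp (C t) = c t) (hC : HasDerivAt C C' t) :
    HasMFDerivAt 𝓘(ℝ, ℝ) (𝓡 1) c t ((1 : ℝ →L[ℝ] ℝ).smulRight (C' • angleField (c t))) := by
  obtain rfl : (fun t => Circle.exp (C t)) = c := funext hc
  refine (hasMFDerivAt_exp_comp hC).congr_mfderiv ?_
  rw [angleField_exp]

/-- The differential of a map of the circle in terms of a lift. -/
theorem IsLift.mfderiv_apply {φ : Circle → Circle} {Φ : ℝ → ℝ} (h : IsLift φ Φ)
    (hφ : MDifferentiable (𝓡 1) (𝓡 1) φ) (θ : ℝ) :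
    mfderiv (𝓡 1) (𝓡 1) φ (Circle.exp θ) (angleField (Circle.exp θ)) =
      deriv Φ θ • angleField (φ (Circle.exp θ)) := by
  have h1 := (hφ (Circle.exp θ)).hasMFDerivAt.comp θ (hasMFDerivAt_exp θ)
  have h2 := hasMFDerivAt_of_exp (c := φ ∘ fun t : ℝ => Circle.exp t) h.exp_apply (h.hasDerivAt θ)
  have h3 := DFunLike.congr_fun (hasMFDerivAt_unique h1 h2) (1 : ℝ)
  rw [angleField_exp]
  have h4 : mfderiv (𝓡 1) (𝓡 1) φ (Circle.exp θ) (angleVector θ) =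
      (1 : ℝ) • deriv Φ θ • angleField (φ (Circle.exp θ)) := h3
  rw [h4, one_smul]

/-! ### Metrics and gradients in the angular coordinate -/

/-- A function on the circle in the angular coordinate. -/
noncomputable def angular (f : Circle → ℝ) (θ : ℝ) : ℝ := f (Circle.exp θ)

theorem angular_periodic (f : Circle → ℝ) : Function.Periodic (angular f) (2 * Real.pi) :=
  fun θ => by rw [angular, angular, Circle.exp_add_two_pi]

theorem contDiff_angular {f : Circle → ℝ} (hf : ContMDiff (𝓡 1) 𝓘(ℝ, ℝ) ∞ f) :
    ContDiff ℝ ∞ (angular f) :=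
  (hf.comp contMDiff_circleExp).contDiff

theorem IsMorse.simpleZeros {f : Circle → ℝ} (hf : IsMorse f) :
    SimpleZeros (deriv (angular f)) where
  smooth := (contDiff_angular hf.1).iterate_deriv 1
  simple x hx := by
    have := hf.2 x hx
    rwa [iteratedDeriv_succ, iteratedDeriv_one] at this

namespace Metric

theorem coeff_eq (g : Metric) (θ : ℝ) : g.coeff θ =
    g.inner (Circle.exp θ) (angleField (Circle.exp θ)) (angleField (Circle.exp θ)) := by
  rw [angleField_exp]
  rfl

theorem coeff_pos (g : Metric) (θ : ℝ) : 0 < g.coeff θ := g.pos _ _ (angleVector_ne_zero θ)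

theorem coeff_periodic (g : Metric) : Function.Periodic g.coeff (2 * Real.pi) := fun θ => by
  rw [coeff_eq, coeff_eq, Circle.exp_add_two_pi]

theorem contMDiff_angleVector : ContMDiff 𝓘(ℝ, ℝ) (𝓡 1).tangent ∞
    (fun θ : ℝ => (⟨Circle.exp θ, angleVector θ⟩ : TangentBundle (𝓡 1) Circle)) := by
  have h1 : ContMDiff 𝓘(ℝ, ℝ) 𝓘(ℝ, ℝ).tangent ∞
      (fun θ : ℝ => (⟨θ, (1 : ℝ)⟩ : TangentBundle 𝓘(ℝ, ℝ) ℝ)) :=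
    contMDiff_vectorSpace_iff_contDiff.2 contDiff_const
  exact (contMDiff_circleExp.contMDiff_tangentMap (n := ∞) (m := ∞) (by simp)).comp h1

theorem coeff_smooth (g : Metric) : ContDiff ℝ ∞ g.coeff := by
  have h : ContMDiff 𝓘(ℝ, ℝ) ((𝓡 1).prod 𝓘(ℝ, ℝ)) ∞ (fun θ : ℝ =>
      Bundle.TotalSpace.mk' ℝ (E := Bundle.Trivial Circle ℝ) (Circle.exp θ)
        (g.inner (Circle.exp θ) (angleVector θ) (angleVector θ))) :=
    ContMDiff.clm_bundle_apply₂ (F₁ := EuclideanSpace ℝ (Fin 1)) (F₂ := EuclideanSpace ℝ (Fin 1))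
      (g.contMDiff.comp contMDiff_circleExp) contMDiff_angleVector contMDiff_angleVector
  rw [← contMDiff_iff_contDiff]
  intro θ
  have := h θ
  rw [Bundle.contMDiffAt_totalSpace] at this
  exact this.2

end Metric

theorem mfderiv_angleField {f : Circle → ℝ} (hf : ContMDiff (𝓡 1) 𝓘(ℝ, ℝ) ∞ f) (θ : ℝ) :
    mfderiv (𝓡 1) 𝓘(ℝ, ℝ) f (Circle.exp θ) (angleField (Circle.exp θ)) =
      deriv (angular f) θ := by
  rw [angleField_exp]
  have h1 := (hf.mdifferentiable (by simp) (Circle.exp θ)).hasMFDerivAt.comp θ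
    (hasMFDerivAt_exp θ)
  have h2 := ((contDiff_angular hf).differentiable (by simp) θ).hasDerivAt.hasFDerivAt.hasMFDerivAt
  have h3 := DFunLike.congr_fun (hasMFDerivAt_unique h1 h2) (1 : ℝ)
  have h4 : mfderiv (𝓡 1) 𝓘(ℝ, ℝ) f (Circle.exp θ) (angleVector θ) =
    (1 : ℝ) • deriv (angular f) θ := h3
  rw [h4, one_smul]

theorem grad_exp (g : Metric) {f : Circle → ℝ} (hf : ContMDiff (𝓡 1) 𝓘(ℝ, ℝ) ∞ f) (θ : ℝ) :
    grad g f (Circle.exp θ) =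
      (deriv (angular f) θ / g.coeff θ) • angleField (Circle.exp θ) := by
  obtain ⟨c, hc⟩ := exists_eq_smul_angleField _ (grad g f (Circle.exp θ))
  have h1 := grad_spec g f (Circle.exp θ) (angleField (Circle.exp θ))
  rw [mfderiv_angleField hf, hc, map_smul, _root_.smul_apply, ← g.coeff_eq,
    smul_eq_mul] at h1
  rw [hc, ← h1, mul_div_cancel_right₀ _ (g.coeff_pos θ).ne']

theorem mem_Aut_iff (g : Metric) {f : Circle → ℝ} (hf : ContMDiff (𝓡 1) 𝓘(ℝ, ℝ) ∞ f) {φ : Diff}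
    {Φ : ℝ → ℝ} (hΦ : IsLift φ Φ) : φ ∈ Aut (grad g f) ↔ ∀ θ,
      deriv (angular f) (Φ θ) * g.coeff θ = deriv Φ θ * deriv (angular f) θ * g.coeff (Φ θ) := by
  have key : ∀ θ, mfderiv (𝓡 1) (𝓡 1) φ (Circle.exp θ) (grad g f (Circle.exp θ)) =
      grad g f (φ (Circle.exp θ)) ↔
      deriv (angular f) (Φ θ) * g.coeff θ = deriv Φ θ * deriv (angular f) θ * g.coeff (Φ θ) := by
    intro θ
    rw [grad_exp g hf, map_smul, hΦ.mfderiv_apply (φ.mdifferentiable (by simp)),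
      ← hΦ.exp_apply, grad_exp g hf, smul_smul]
    have h1 := (g.coeff_pos θ).ne'
    have h2 := (g.coeff_pos (Φ θ)).ne'
    constructor
    · intro h
      have := smul_angleField_injective h
      field_simp at this
      linarith
    · intro h
      congr 1
      field_simp
      linarith
  constructor
  · exact fun h θ => (key θ).1 (h _)
  · intro h z
    obtain ⟨θ, rfl⟩ := Circle.exp_surjective z
    exact (key θ).2 (h θ)

theorem exists_lift_of_isMIntegralCurve (g : Metric) {f : Circle → ℝ}
    (hf : ContMDiff (𝓡 1) 𝓘(ℝ, ℝ) ∞ f) {c : ℝ → Circle}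
    (hc : IsMIntegralCurve (I := 𝓡 1) c (grad g f)) :
    ∃ C : ℝ → ℝ, (∀ t, Circle.exp (C t) = c t) ∧
      ∀ s, HasDerivAt C (deriv (angular f) (C s) / g.coeff (C s)) s := by
  have hcc : Continuous c := continuous_iff_continuousAt.2 fun t => (hc t).continuousAt
  obtain ⟨C, hC, -, hCc⟩ := exists_continuous_lift hcc (t₀ := 0) (Circle.exp_arg (c 0))
  refine ⟨C, hCc, fun s => ?_⟩
  have hd : DifferentiableAt ℝ C s := differentiableAt_of_exp hC.continuousAt (by
    simp only [hCc]
    exact (hc s).mdifferentiableAt)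
  have h1 := hasMFDerivAt_of_exp hCc hd.hasDerivAt
  have h2 := DFunLike.congr_fun (hasMFDerivAt_unique h1 (hc s)) (1 : ℝ)
  have h3 : (1 : ℝ) • deriv C s • angleField (c s) = (1 : ℝ) • grad g f (c s) := h2
  rw [one_smul, one_smul, ← hCc, grad_exp g hf] at h3
  rw [← smul_angleField_injective h3]
  exact hd.hasDerivAt

theorem isMIntegralCurve_exp (g : Metric) {f : Circle → ℝ}
    (hf : ContMDiff (𝓡 1) 𝓘(ℝ, ℝ) ∞ f) {C : ℝ → ℝ}
    (hC : ∀ s, HasDerivAt C (deriv (angular f) (C s) / g.coeff (C s)) s) :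
    IsMIntegralCurve (I := 𝓡 1) (fun t => Circle.exp (C t)) (grad g f) := by
  intro s
  have := hasMFDerivAt_of_exp (c := fun t => Circle.exp (C t)) (fun _ => rfl) (hC s)
  rwa [← grad_exp g hf] at this

/-! ### Automorphisms of a gradient field -/

variable {f : Circle → ℝ}

/-- An orientation preserving automorphism with a fixed point is a flow map. -/
theorem mem_flowSubgroup_of_fixed (hf : IsMorse f) (g : Metric) (φ : Aut (grad g f))
    (hpres : Preserving (φ : Diff)) {p : ℝ}
    (hfix : (φ : Diff) (Circle.exp p) = Circle.exp p) : φ ∈ flowSubgroup (grad g f) := by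
  obtain ⟨Φ, hΦ, hΦp⟩ := exists_isLift (φ : Diff).contMDiff hfix.symm
  obtain ⟨Ψ, hΨ, hΨ0⟩ := hpres
  have hd : ∀ x, 0 < deriv Φ x := fun x => by rw [hΦ.deriv_eq hΨ]; exact hΨ0 x
  have hconj := (mem_Aut_iff g hf.1 hΦ).1 φ.2
  have hk := hf.simpleZeros
  have hpi := Real.two_pi_pos
  have hper : Function.Periodic (fun x => Φ x - x) (2 * Real.pi) := fun x => by
    simp only [hΦ.degree_one hd x]
    ring
  -- Degree one makes all translates of `p` fixed points, so each critical point lies between two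
  -- consecutive ones and `map_eq_self` applies.
  have hpn : ∀ n : ℤ, Φ (p + n * (2 * Real.pi)) = p + n * (2 * Real.pi) := fun n => by
    have := hper.int_mul n p
    simp only [hΦp, sub_self] at this
    linarith
  have hz : ∀ x, deriv (angular f) x = 0 → deriv (angular f) (Φ x) = 0 := fun x hx => by
    have := hconj x
    rw [hx, mul_zero, zero_mul] at this
    exact (mul_eq_zero.1 this).resolve_right (g.coeff_pos x).ne'
  have hall : ∀ x, deriv (angular f) x = 0 → Φ x = x := fun x hx => by
    have h1 := Int.floor_le ((x - p) / (2 * Real.pi))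
    have h2 := (Int.lt_floor_add_one ((x - p) / (2 * Real.pi))).le
    rw [le_div_iff₀ hpi] at h1
    rw [div_le_iff₀ hpi] at h2
    refine hk.map_eq_self (strictMono_of_deriv_pos hd) hz
      (hpn ⌊(x - p) / (2 * Real.pi)⌋) (hpn (⌊(x - p) / (2 * Real.pi)⌋ + 1)) ⟨?_, ?_⟩ hx
    · linarith
    · push_cast
      linarith
  obtain ⟨t₀, ht₀⟩ := hk.exists_flow_time g.coeff_smooth g.coeff_pos hpi
    (deriv_periodic (angular_periodic f)) g.coeff_periodic hΦ.smooth hd hconj hall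
  refine ⟨t₀, fun c hc s => ?_⟩
  obtain ⟨C, hCc, hC⟩ := exists_lift_of_isMIntegralCurve g hf.1 hc
  rw [← hCc, ← hΦ.exp_apply, ht₀ C hC s, hCc]

/-- If the principal value of `1 / ∇f` is nonzero, all automorphisms preserve orientation. -/
theorem not_reversing (hf : IsMorse f) (g : Metric)
    (hpv : principalValue (deriv (angular f)) g.coeff ≠ 0) {φ : Diff} (hφ : φ ∈ Aut (grad g f)) :
    ¬ Reversing φ := by
  rintro ⟨Φ, hΦ, hd⟩
  obtain ⟨n, hn⟩ := hΦ.exists_degree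
  have h1 := hf.simpleZeros.mul_principalValue g.coeff_smooth g.coeff_pos
    (deriv_periodic (angular_periodic f)) g.coeff_periodic hΦ.smooth (fun x => (hd x).ne)
    ((mem_Aut_iff g hf.1 hΦ).1 hφ) hn
  have h2 := Reversing.degree_neg hΦ hd hn
  have h3 : (n : ℝ) = 1 := mul_right_cancel₀ hpv (by rw [h1, one_mul])
  have h4 : n = 1 := by exact_mod_cast h3
  omega

/-- Automorphisms permute the critical points and preserve the eigenvalues of the
linearizations. -/
theorem Aut_map_critical (hf : IsMorse f) (g : Metric) {φ : Diff} (hφ : φ ∈ Aut (grad g f))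
    {p q : ℝ} (hp : deriv (angular f) p = 0) (hq : φ (Circle.exp p) = Circle.exp q) :
    deriv (angular f) q = 0 ∧
      deriv (deriv (angular f)) q * g.coeff p = g.coeff q * deriv (deriv (angular f)) p := by
  obtain ⟨Φ, hΦ, rfl⟩ := exists_isLift φ.contMDiff hq.symm
  have hconj := (mem_Aut_iff g hf.1 hΦ).1 hφ
  have h0 : deriv (angular f) (Φ p) = 0 := by
    have := hconj p
    rw [hp, mul_zero, zero_mul] at this
    exact (mul_eq_zero.1 this).resolve_right (g.coeff_pos p).ne'
  exact ⟨h0, hf.simpleZeros.deriv_map_mul g.coeff_smooth hΦ.smooth (hΦ.deriv_ne_zero p) hconj hp h0⟩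

/-- A flow map that preserves `f` is the identity. -/
theorem eq_one_of_mem_flowSubgroup (hf : IsMorse f) (g : Metric) (φ : Aut (grad g f))
    (hφf : ∀ z, f ((φ : Diff) z) = f z) (hφ : φ ∈ flowSubgroup (grad g f)) (z : Circle) :
    (φ : Diff) z = z := by
  have hk := hf.simpleZeros
  have hkp := deriv_periodic (angular_periodic f)
  obtain ⟨t, ht⟩ := hφ
  obtain ⟨C, hC0, hC⟩ := exists_ode_solution_of_periodic
    (h := fun x => deriv (angular f) x / g.coeff x)
    (hk.smooth.div g.coeff_smooth fun x => (g.coeff_pos x).ne') Real.two_pi_pos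
    (hkp.div g.coeff_periodic) (Complex.arg z)
  have hz : Circle.exp (C 0) = z := by rw [hC0, Circle.exp_arg]
  have hm : ∀ s, (φ : Diff) (Circle.exp (C s)) = Circle.exp (C (s + t)) :=
    ht _ (isMIntegralCurve_exp g hf.1 hC)
  have h0 := hm 0
  rw [hz, zero_add] at h0
  suffices C t = C 0 by rw [h0, this, hz]
  by_cases ht0 : t = 0
  · rw [ht0]
  have hd : ∀ s, HasDerivAt (fun s => angular f (C s))
      (deriv (angular f) (C s) * (deriv (angular f) (C s) / g.coeff (C s))) s := fun s =>
    (((contDiff_angular hf.1).differentiable (by simp) (C s)).hasDerivAt).comp s (hC s)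
  have heq : angular f (C t) = angular f (C 0) := by
    rw [angular, angular, ← h0, hφf, hz]
  -- Along the curve `f` has derivative `k² / a`. As `f` takes equal values at times `0` and `t`,
  -- Rolle's theorem gives a critical point on the curve, which is then constant.
  have hcrit : ∃ s, deriv (angular f) (C s) = 0 := by
    have hc : Continuous fun s => angular f (C s) :=
      continuous_iff_continuousAt.2 fun s => (hd s).continuousAt
    have : ∃ s, deriv (angular f) (C s) * (deriv (angular f) (C s) / g.coeff (C s)) = 0 := by
      rcases lt_or_gt_of_ne ht0 with h | h
      · obtain ⟨s, -, hs⟩ := exists_hasDerivAt_eq_zero h hc.continuousOn heq fun s _ => hd s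
        exact ⟨s, hs⟩
      · obtain ⟨s, -, hs⟩ := exists_hasDerivAt_eq_zero h hc.continuousOn heq.symm fun s _ => hd s
        exact ⟨s, hs⟩
    obtain ⟨s, hs⟩ := this
    refine ⟨s, ?_⟩
    have := (g.coeff_pos (C s)).ne'
    simpa [this] using hs
  obtain ⟨s, hs⟩ := hcrit
  rw [hk.eq_const_of_zero g.coeff_smooth g.coeff_pos Real.two_pi_pos hkp g.coeff_periodic hC hs]

theorem exists_critical (hf : ContMDiff (𝓡 1) 𝓘(ℝ, ℝ) ∞ f) : ∃ p, deriv (angular f) p = 0 := by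
  have h := angular_periodic f 0
  rw [zero_add] at h
  obtain ⟨p, -, hp⟩ := exists_deriv_eq_zero Real.two_pi_pos
    (contDiff_angular hf).continuous.continuousOn h.symm
  exact ⟨p, hp⟩

/-! ### Group actions -/

section Action

variable {Γ : Type*} [Group Γ] [MulAction Γ Circle]

/-- The homomorphism to `Diff(S¹)` given by a smooth action. -/
noncomputable def toDiff
    (hs : ∀ γ : Γ, ContMDiff (𝓡 1) (𝓡 1) ∞ (fun z : Circle => γ • z)) : Γ →* Diff where
  toFun γ :=
    { toEquiv := MulAction.toPerm γ
      contMDiff_toFun := hs γ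
      contMDiff_invFun := hs γ⁻¹ }
  map_one' := Diffeomorph.ext fun z => one_smul Γ z
  map_mul' γ γ' := Diffeomorph.ext fun z => mul_smul γ γ' z

theorem IsLift.deriv_angular_mul (hf : ContMDiff (𝓡 1) 𝓘(ℝ, ℝ) ∞ f) {γ : Γ}
    (hfγ : ∀ z, f (γ • z) = f z) {Φ : ℝ → ℝ} (hΦ : IsLift (fun z => γ • z) Φ) (x : ℝ) :
    deriv (angular f) (Φ x) * deriv Φ x = deriv (angular f) x := by
  have h1 := (((contDiff_angular hf).differentiable (by simp) (Φ x)).hasDerivAt).comp x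
    (hΦ.hasDerivAt x)
  have h2 : angular f ∘ Φ = angular f := funext fun y => by
    rw [Function.comp_apply, angular, hΦ.exp_apply, hfγ, angular]
  rw [h2] at h1
  exact h1.deriv.symm

theorem IsLift.coeff_mul (hs : ∀ γ : Γ, ContMDiff (𝓡 1) (𝓡 1) ∞ (fun z : Circle => γ • z))
    {g : Metric} (hg : g ∈ invariantMetrics Γ) {γ : Γ} {Φ : ℝ → ℝ}
    (hΦ : IsLift (fun z => γ • z) Φ) (x : ℝ) :
    g.coeff (Φ x) * deriv Φ x ^ 2 = g.coeff x := by
  have h := hg γ (Circle.exp x) (angleField _) (angleField _)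
  rw [hΦ.mfderiv_apply ((hs γ).mdifferentiable (by simp)), map_smul, map_smul,
    _root_.smul_apply, ← g.coeff_eq, ← hΦ.exp_apply, ← g.coeff_eq, smul_eq_mul, smul_eq_mul] at h
  rw [← h]
  ring

/-- Under an invariant change of coordinate `f'` scales by `1 / Φ'` and the metric coefficient by `1
/ Φ'²`, so their quotient scales by `Φ'`, as a vector field should. -/
theorem toDiff_mem_Aut (hs : ∀ γ : Γ, ContMDiff (𝓡 1) (𝓡 1) ∞ (fun z : Circle => γ • z))
    (hf : ContMDiff (𝓡 1) 𝓘(ℝ, ℝ) ∞ f) (hfΓ : ∀ (γ : Γ) (z : Circle), f (γ • z) = f z)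
    {g : Metric} (hg : g ∈ invariantMetrics Γ) (γ : Γ) : toDiff hs γ ∈ Aut (grad g f) := by
  obtain ⟨Φ, hΦ, -⟩ := exists_isLift (hs γ) (Circle.exp_arg (γ • Circle.exp 0))
  refine (mem_Aut_iff g hf (φ := toDiff hs γ) hΦ).2 fun x => ?_
  rw [← hΦ.deriv_angular_mul hf (hfΓ γ) x, ← hΦ.coeff_mul hs hg x]
  ring

end Action

/-! ### The topology on metrics -/

theorem tendstoUniformly_iteratedDeriv_coeff (k : ℕ) (g : Metric) :
    TendstoUniformly (fun g' : Metric => iteratedDeriv k g'.coeff) (iteratedDeriv k g.coeff)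
      (𝓝 g) := by
  have h : Continuous fun g' : Metric => UniformFun.ofFun (iteratedDeriv k g'.coeff) :=
    (continuous_apply k).comp
      (continuous_induced_dom (f := fun g : Metric => fun k : ℕ =>
        UniformFun.ofFun (iteratedDeriv k (Metric.coeff g))))
  exact UniformFun.tendsto_iff_tendstoUniformly.1 (h.tendsto g)

theorem continuous_coeff_apply (θ : ℝ) : Continuous fun g : Metric => g.coeff θ :=
  continuous_iff_continuousAt.2 fun g => by
    simpa [ContinuousAt] using (tendstoUniformly_iteratedDeriv_coeff 0 g).tendsto_at θ

theorem continuous_integral_iteratedDeriv_coeff (k : ℕ) {w : ℝ → ℝ} {a b : ℝ}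
    (hw : IntervalIntegrable w volume a b) :
    Continuous fun g : Metric => ∫ x in a..b, iteratedDeriv k g.coeff x * w x := by
  have hi : ∀ g : Metric, IntervalIntegrable (fun x => iteratedDeriv k g.coeff x * w x)
      volume a b := fun g =>
    hw.continuousOn_mul
      (g.coeff_smooth.continuous_iteratedDeriv k (by exact_mod_cast le_top)).continuousOn
  refine continuous_iff_continuousAt.2 fun g => Metric.tendsto_nhds.2 fun ε hε => ?_
  set M := |∫ x in a..b, ‖w x‖| with hM
  -- `M + 1` rather than `M`, since the weight may have zero integral norm.
  have hδ : 0 < ε / (M + 1) := by positivity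
  filter_upwards [Metric.tendstoUniformly_iff.1 (tendstoUniformly_iteratedDeriv_coeff k g) _ hδ]
    with g' hg'
  rw [Real.dist_eq, ← intervalIntegral.integral_sub (hi g') (hi g)]
  calc |∫ x in a..b, (iteratedDeriv k g'.coeff x * w x - iteratedDeriv k g.coeff x * w x)|
      ≤ |∫ x in a..b, ε / (M + 1) * ‖w x‖| := by
        refine (Real.norm_eq_abs _).ge.trans <| intervalIntegral.norm_integral_le_abs_of_norm_le
          (ae_of_all _ fun x => ?_) (hw.norm.const_mul _)
        rw [← sub_mul, norm_mul]
        refine mul_le_mul_of_nonneg_right ?_ (norm_nonneg _)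
        have := (hg' x).le
        rwa [dist_comm, Real.dist_eq] at this
    _ = ε / (M + 1) * M := by
        rw [intervalIntegral.integral_const_mul, abs_mul, abs_of_pos hδ]
    _ < ε := by
        rw [div_mul_eq_mul_div, div_lt_iff₀ (by positivity)]
        nlinarith [abs_nonneg (∫ x in a..b, ‖w x‖)]

/-! ### Dependence of the principal value on the metric -/

section PrincipalValue

variable {k a b : ℝ → ℝ}

/-- Separates `a` and `a'`, each against an integrable weight that depends on `k` only; continuity
in the metric is then immediate. -/
theorem principalValue_eq (hk : SimpleZeros k) (ha : ContDiff ℝ ∞ a) :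
    principalValue k a =
      (∫ x in (0 : ℝ)..2 * Real.pi,
        a x * (bezoutSelf k x - deriv (bezoutDeriv k) x * Real.log (k x))) +
      ∫ x in (0 : ℝ)..2 * Real.pi, deriv a x * (-(bezoutDeriv k x * Real.log (k x))) := by
  rw [← intervalIntegral.integral_add, principalValue]
  · congr 1
    funext x
    have h : deriv (fun y => a y * bezoutDeriv k y) x =
        deriv a x * bezoutDeriv k x + a x * deriv (bezoutDeriv k) x :=
      deriv_fun_mul (ha.differentiable (by simp) x)
        (hk.bezoutDeriv_smooth.differentiable (by simp) x)
    rw [regDensity, h]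
    ring
  · exact ((hk.bezoutSelf_smooth.continuous.intervalIntegrable _ _).sub
      (hk.intervalIntegrable_mul_log
        (SimpleZeros.continuous_deriv_of_smooth hk.bezoutDeriv_smooth) _ _)).continuousOn_mul
      ha.continuous.continuousOn
  · exact (hk.intervalIntegrable_mul_log hk.bezoutDeriv_smooth.continuous _ _).neg.continuousOn_mul
      (SimpleZeros.continuous_deriv_of_smooth ha).continuousOn

theorem principalValue_add_smul (hk : SimpleZeros k) (ha : ContDiff ℝ ∞ a)
    (hb : ContDiff ℝ ∞ b) (s : ℝ) :
    principalValue k (fun x => a x + s * b x) = principalValue k a + s * principalValue k b := by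
  have hd : ∀ x, deriv (fun y => (a y + s * b y) * bezoutDeriv k y) x =
      deriv (fun y => a y * bezoutDeriv k y) x + s * deriv (fun y => b y * bezoutDeriv k y) x := by
    intro x
    have h1 := ((hk.weight_smooth ha).differentiable (by simp) x).hasDerivAt
    have h2 := ((hk.weight_smooth hb).differentiable (by simp) x).hasDerivAt
    have h3 := h1.add (h2.const_mul s)
    have h4 : (fun y => (a y + s * b y) * bezoutDeriv k y) =
        (fun y => a y * bezoutDeriv k y) + fun y => s * (b y * bezoutDeriv k y) := by
      funext y
      simp only [Pi.add_apply]
      ring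
    rw [h4]
    exact h3.deriv
  rw [principalValue, principalValue, principalValue, ← intervalIntegral.integral_const_mul,
    ← intervalIntegral.integral_add (hk.intervalIntegrable_regDensity ha _ _)
      ((hk.intervalIntegrable_regDensity hb _ _).const_mul s)]
  congr 1
  funext x
  rw [regDensity, regDensity, regDensity, hd]
  ring

theorem continuous_principalValue_coeff (hk : SimpleZeros k) :
    Continuous fun g : Metric => principalValue k g.coeff := by
  have h0 := continuous_integral_iteratedDeriv_coeff 0 (a := 0) (b := 2 * Real.pi)
    ((hk.bezoutSelf_smooth.continuous.intervalIntegrable _ _).sub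
      (hk.intervalIntegrable_mul_log
        (SimpleZeros.continuous_deriv_of_smooth hk.bezoutDeriv_smooth) _ _))
  have h1 := continuous_integral_iteratedDeriv_coeff 1 (a := 0) (b := 2 * Real.pi)
    (hk.intervalIntegrable_mul_log hk.bezoutDeriv_smooth.continuous _ _).neg
  refine (h0.add h1).congr fun g => ?_
  rw [principalValue_eq hk g.coeff_smooth]
  simp only [iteratedDeriv_zero, iteratedDeriv_one]
  rfl

end PrincipalValue

/-! ### Conformal perturbations -/

/-- The metric `g` multiplied by a positive function. -/
noncomputable def Metric.conformal (g : Metric) (ρ : Circle → ℝ)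
    (hρ : ContMDiff (𝓡 1) 𝓘(ℝ, ℝ) ∞ ρ) (hpos : ∀ z, 0 < ρ z) : Metric where
  inner z := ρ z • g.inner z
  symm z v w := congrArg (ρ z * ·) (g.symm z v w)
  pos z v hv := mul_pos (hpos z) (g.pos z v hv)
  isVonNBounded z := by
    -- The unit ball of `ρ g` is the unit ball of `g` scaled by `1 / √ρ`.
    let L : TangentSpace (𝓡 1) z →L[ℝ] TangentSpace (𝓡 1) z :=
      (Real.sqrt (ρ z))⁻¹ • ContinuousLinearMap.id ℝ _
    refine ((g.isVonNBounded z).image L).subset fun v hv =>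
      (mem_image _ _ _).2 ⟨Real.sqrt (ρ z) • v, ?_, ?_⟩
    · have hv : ρ z * g.inner z v v < 1 := hv
      have : g.inner z (Real.sqrt (ρ z) • v) (Real.sqrt (ρ z) • v) = ρ z * g.inner z v v := by
        rw [map_smul, map_smul, _root_.smul_apply, smul_eq_mul, smul_eq_mul, ← mul_assoc,
          Real.mul_self_sqrt (hpos z).le]
      exact this.trans_lt hv
    · have : Real.sqrt (ρ z) ≠ 0 := (Real.sqrt_pos.2 (hpos z)).ne'
      exact inv_smul_smul₀ this v
  contMDiff := hρ.smul_section g.contMDiff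

theorem Metric.coeff_conformal (g : Metric) {ρ : Circle → ℝ}
    (hρ : ContMDiff (𝓡 1) 𝓘(ℝ, ℝ) ∞ ρ) (hpos : ∀ z, 0 < ρ z) (θ : ℝ) :
    (g.conformal ρ hρ hpos).coeff θ = ρ (Circle.exp θ) * g.coeff θ := rfl

theorem Metric.conformal_mem {Γ : Type*} [SMul Γ Circle] {g : Metric}
    (hg : g ∈ invariantMetrics Γ) {ρ : Circle → ℝ} (hρ : ContMDiff (𝓡 1) 𝓘(ℝ, ℝ) ∞ ρ)
    (hpos : ∀ z, 0 < ρ z) (hinv : ∀ (γ : Γ) z, ρ (γ • z) = ρ z) :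
    g.conformal ρ hρ hpos ∈ invariantMetrics Γ := fun γ z v w => by
  have h : ρ (γ • z) * g.inner (γ • z) (mfderiv (𝓡 1) (𝓡 1) (fun y : Circle => γ • y) z v)
      (mfderiv (𝓡 1) (𝓡 1) (fun y : Circle => γ • y) z w) = ρ z * g.inner z v w := by
    rw [hg γ z v w, hinv]
  exact h

/-- The path is `(1 + s η) g`, replaced by `g` when the factor is not positive; compactness of the
circle makes it positive for small `s`. -/
theorem exists_path_metric {Γ : Type*} [SMul Γ Circle] {g : Metric}
    (hg : g ∈ invariantMetrics Γ) {η : Circle → ℝ} (hη : ContMDiff (𝓡 1) 𝓘(ℝ, ℝ) ∞ η)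
    (hinv : ∀ (γ : Γ) z, η (γ • z) = η z) :
    ∃ G : ℝ → invariantMetrics Γ, Tendsto G (𝓝 0) (𝓝 ⟨g, hg⟩) ∧
      ∀ᶠ s in 𝓝 0, (G s).1.coeff = fun θ => g.coeff θ + s * (η (Circle.exp θ) * g.coeff θ) := by
  have hcont : ∀ s, ContMDiff (𝓡 1) 𝓘(ℝ, ℝ) ∞ fun z => 1 + s * η z := fun s =>
    contMDiff_const.add (contMDiff_const.mul hη)
  obtain ⟨M, hM⟩ := isBounded_iff_forall_norm_le.1 (isCompact_range hη.continuous).isBounded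
  have hpos : ∀ᶠ s : ℝ in 𝓝 0, ∀ z, 0 < 1 + s * η z := by
    have h1 : Tendsto (fun s : ℝ => |s| * M) (𝓝 0) (𝓝 0) := by
      simpa using (continuous_abs.tendsto (0 : ℝ)).mul_const M
    filter_upwards [h1.eventually_lt_const one_pos] with s hs z
    have h2 : |s * η z| ≤ |s| * M := by
      rw [abs_mul]
      exact mul_le_mul_of_nonneg_left (hM _ (mem_range_self z)) (abs_nonneg s)
    linarith [(abs_le.1 h2).1]
  classical
  let G : ℝ → invariantMetrics Γ := fun s =>
    if h : ∀ z, 0 < 1 + s * η z then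
      ⟨g.conformal _ (hcont s) h, Metric.conformal_mem hg _ h fun γ z => by rw [hinv]⟩
    else ⟨g, hg⟩
  have hG : ∀ᶠ s in 𝓝 0,
      (G s).1.coeff = fun θ => g.coeff θ + s * (η (Circle.exp θ) * g.coeff θ) := by
    filter_upwards [hpos] with s hs
    have : G s = ⟨g.conformal _ (hcont s) hs,
      Metric.conformal_mem hg _ hs fun γ z => by rw [hinv]⟩ := dif_pos hs
    rw [this]
    funext θ
    rw [Metric.coeff_conformal]
    ring
  refine ⟨G, ?_, hG⟩
  have hs : ContDiff ℝ ∞ fun θ => η (Circle.exp θ) * g.coeff θ :=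
    (contDiff_angular hη).mul g.coeff_smooth
  have hsp : Function.Periodic (fun θ => η (Circle.exp θ) * g.coeff θ) (2 * Real.pi) :=
    (angular_periodic η).mul g.coeff_periodic
  have hper : ∀ k, Function.Periodic
      (iteratedDeriv k fun θ => η (Circle.exp θ) * g.coeff θ) (2 * Real.pi) := by
    intro k
    induction k with
    | zero => simpa using hsp
    | succ k ih =>
      rw [iteratedDeriv_succ]
      exact deriv_periodic ih
  rw [tendsto_subtype_rng, nhds_induced, tendsto_comap_iff, tendsto_pi_nhds]
  intro k
  rw [UniformFun.tendsto_iff_tendstoUniformly, Metric.tendstoUniformly_iff]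
  intro ε hε
  obtain ⟨B, hB⟩ := isBounded_iff_forall_norm_le.1
    ((hper k).isBounded_of_continuous Real.two_pi_pos.ne'
      (hs.continuous_iteratedDeriv k (by exact_mod_cast le_top)))
  have h1 : Tendsto (fun s : ℝ => |s| * B) (𝓝 0) (𝓝 0) := by
    simpa using (continuous_abs.tendsto (0 : ℝ)).mul_const B
  filter_upwards [hG, h1.eventually_lt_const hε] with s hGs hsε θ
  have h2 : iteratedDeriv k (G s).1.coeff θ = iteratedDeriv k g.coeff θ +
      s * iteratedDeriv k (fun θ => η (Circle.exp θ) * g.coeff θ) θ := by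
    rw [hGs, iteratedDeriv_fun_add, iteratedDeriv_const_mul_field]
    · exact g.coeff_smooth.contDiffAt.of_le (by exact_mod_cast le_top)
    · exact (contDiff_const.mul hs).contDiffAt.of_le (by exact_mod_cast le_top)
  have h3 : dist (iteratedDeriv k g.coeff θ) (iteratedDeriv k (G s).1.coeff θ) < ε := by
    rw [dist_comm, h2, Real.dist_eq, add_sub_cancel_left, abs_mul]
    exact (mul_le_mul_of_nonneg_left (hB _ (mem_range_self θ)) (abs_nonneg s)).trans_lt hsε
  exact h3

/-- Along the conformal path `L` is affine in `s` with nonzero slope, hence nonzero for all small `s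
≠ 0`, whatever its value at `g`. -/
theorem dense_ne_zero {Γ : Type*} [SMul Γ Circle] (L : (ℝ → ℝ) → ℝ)
    (hL : ∀ g ∈ invariantMetrics Γ, ∃ η : Circle → ℝ, ContMDiff (𝓡 1) 𝓘(ℝ, ℝ) ∞ η ∧
      (∀ (γ : Γ) z, η (γ • z) = η z) ∧ ∃ c : ℝ, c ≠ 0 ∧ ∀ s,
        L (fun θ => g.coeff θ + s * (η (Circle.exp θ) * g.coeff θ)) = L g.coeff + s * c) :
    Dense {g : invariantMetrics Γ | L g.1.coeff ≠ 0} := by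
  rintro ⟨g, hg⟩
  obtain ⟨η, hη, hinv, c, hc, hLc⟩ := hL g hg
  obtain ⟨G, hG, hGc⟩ := exists_path_metric hg hη hinv
  refine mem_closure_of_tendsto (hG.mono_left (nhdsWithin_le_nhds (s := {0}ᶜ))) ?_
  have hd : HasDerivAt (fun s => L g.coeff + s * c) c 0 := by
    simpa using ((hasDerivAt_id (0 : ℝ)).mul_const c).const_add (L g.coeff)
  filter_upwards [hGc.filter_mono nhdsWithin_le_nhds, hd.eventually_ne (c := 0) hc] with s h1 h2
  have h3 : L (G s).1.coeff ≠ 0 := by rwa [h1, hLc]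
  exact h3

/-! ### Generic invariant metrics -/

section Generic

variable {Γ : Type*} [Group Γ] [MulAction Γ Circle] {f : Circle → ℝ}

/-- An invariant function that vanishes exactly on the orbit of `q`. -/
theorem exists_invariant_vanishing [Finite Γ]
    (hs : ∀ γ : Γ, ContMDiff (𝓡 1) (𝓡 1) ∞ (fun z : Circle => γ • z)) (q : Circle) :
    ∃ η : Circle → ℝ, ContMDiff (𝓡 1) 𝓘(ℝ, ℝ) ∞ η ∧ (∀ (γ : Γ) z, η (γ • z) = η z) ∧
      ∀ z, η z = 0 ↔ ∃ γ : Γ, γ • z = q := by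
  have := Fintype.ofFinite Γ
  -- The product over `Γ` gives invariance, and the squares keep each factor smooth where it
  -- vanishes.
  refine ⟨fun z => ∏ γ : Γ, ‖((γ • z : Circle) : ℂ) - q‖ ^ 2, ?_, fun γ z => ?_, fun z => ?_⟩
  · refine contMDiff_finsetProd fun γ _ => ?_
    have h1 : ContDiff ℝ ∞ fun w : ℂ => ‖w - q‖ ^ 2 :=
      (contDiff_id.sub contDiff_const).norm_sq ℝ
    exact h1.contMDiff.comp (contMDiff_coe_circle.comp (hs γ))
  · simp only [smul_smul]
    exact Fintype.prod_equiv (Equiv.mulRight γ) _ _ fun _ => rfl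
  · rw [Finset.prod_eq_zero_iff]
    simp [sub_eq_zero, Circle.ext_iff]

/-- The condition says that the eigenvalues at `p` and `q` differ. A perturbation supported off the
orbit of `q` changes the metric at `p` but not at `q`. -/
theorem isOpen_dense_eigenvalue_ne [Finite Γ]
    (hs : ∀ γ : Γ, ContMDiff (𝓡 1) (𝓡 1) ∞ (fun z : Circle => γ • z)) (hf : IsMorse f) {p q : ℝ}
    (hq : deriv (angular f) q = 0) (hpq : ¬ ∃ γ : Γ, γ • Circle.exp p = Circle.exp q) :
    let S : Set (invariantMetrics Γ) := {g | deriv (deriv (angular f)) q * g.1.coeff p -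
      g.1.coeff q * deriv (deriv (angular f)) p ≠ 0}
    IsOpen S ∧ Dense S := by
  refine ⟨isOpen_ne_fun ?_ continuous_const, ?_⟩
  · exact (((continuous_coeff_apply p).const_mul _).sub
      ((continuous_coeff_apply q).mul_const _)).comp continuous_subtype_val
  · refine dense_ne_zero (fun a => deriv (deriv (angular f)) q * a p -
      a q * deriv (deriv (angular f)) p) fun g _ => ?_
    obtain ⟨η, hη, hinv, h0⟩ := exists_invariant_vanishing hs (Circle.exp q)
    refine ⟨η, hη, hinv, deriv (deriv (angular f)) q * (η (Circle.exp p) * g.coeff p),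
      mul_ne_zero (hf.simpleZeros.simple q hq)
        (mul_ne_zero (fun h => hpq ((h0 _).1 h)) (g.coeff_pos p).ne'), fun s => ?_⟩
    have hq0 : η (Circle.exp q) = 0 := (h0 _).2 ⟨1, one_smul _ _⟩
    simp only [hq0]
    ring

/-- The perturbation `η = f' / √a` is the derivative of `f` by `g`-arc length, which is invariant
because `Γ` preserves orientation. It changes the principal value at rate `∫ √a`, the length of the
circle. A reversing element of `Γ` would force the principal value to vanish. -/
theorem isOpen_dense_principalValue_ne
    (hs : ∀ γ : Γ, ContMDiff (𝓡 1) (𝓡 1) ∞ (fun z : Circle => γ • z)) (hf : IsMorse f)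
    (hfΓ : ∀ (γ : Γ) (z : Circle), f (γ • z) = f z)
    (hpres : ∀ γ : Γ, Preserving fun z => γ • z) :
    let S : Set (invariantMetrics Γ) := {g | principalValue (deriv (angular f)) g.1.coeff ≠ 0}
    IsOpen S ∧ Dense S := by
  have hk := hf.simpleZeros
  have hkp := deriv_periodic (angular_periodic f)
  refine ⟨isOpen_ne_fun ((continuous_principalValue_coeff hk).comp continuous_subtype_val)
    continuous_const, dense_ne_zero (principalValue (deriv (angular f))) fun g hg => ?_⟩
  have hsq : ContDiff ℝ ∞ fun x => Real.sqrt (g.coeff x) :=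
    g.coeff_smooth.sqrt fun x => (g.coeff_pos x).ne'
  have hsq0 : ∀ x, 0 < Real.sqrt (g.coeff x) := fun x => Real.sqrt_pos.2 (g.coeff_pos x)
  have hsqp : Function.Periodic (fun x => Real.sqrt (g.coeff x)) (2 * Real.pi) := fun x => by
    simp only [g.coeff_periodic x]
  obtain ⟨η, hη, hηx⟩ := exists_contMDiff_of_periodic
    (G := fun x => deriv (angular f) x / Real.sqrt (g.coeff x))
    (hk.smooth.div hsq fun x => (hsq0 x).ne') (hkp.div hsqp)
  refine ⟨η, hη, fun γ z => ?_, principalValue (deriv (angular f))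
    (fun x => deriv (angular f) x * Real.sqrt (g.coeff x)), ?_, fun s => ?_⟩
  · obtain ⟨θ, rfl⟩ := Circle.exp_surjective z
    obtain ⟨Φ, hΦ, hd⟩ := hpres γ
    have h1 := hΦ.deriv_angular_mul hf.1 (hfΓ γ) θ
    have h2 := hΦ.coeff_mul hs hg θ
    rw [← hΦ.exp_apply θ, hηx, hηx, ← h1, ← h2, Real.sqrt_mul (g.coeff_pos _).le,
      Real.sqrt_sq (hd θ).le]
    have h3 := (hsq0 (Φ θ)).ne'
    have h4 := (hd θ).ne'
    field_simp
  · rw [hk.principalValue_mul_self hkp hsq hsqp]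
    exact (intervalIntegral.intervalIntegral_pos_of_pos_on (hsq.continuous.intervalIntegrable _ _)
      (fun x _ => hsq0 x) Real.two_pi_pos).ne'
  · rw [← principalValue_add_smul hk g.coeff_smooth (hk.smooth.mul hsq)]
    congr 1
    funext x
    have h3 := (hsq0 x).ne'
    rw [hηx]
    congr 2
    rw [div_mul_eq_mul_div, div_eq_iff h3, mul_assoc, Real.mul_self_sqrt (g.coeff_pos x).le]

/-- For generic invariant metrics, every automorphism maps a given critical point into its
orbit. -/
theorem exists_isOpen_dense_orbit [Finite Γ]
    (hs : ∀ γ : Γ, ContMDiff (𝓡 1) (𝓡 1) ∞ (fun z : Circle => γ • z)) (hf : IsMorse f) {p : ℝ}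
    (hp : deriv (angular f) p = 0) :
    ∃ W : Set (invariantMetrics Γ), IsOpen W ∧ Dense W ∧ ∀ g ∈ W, ∀ φ ∈ Aut (grad g.1 f),
      ∃ γ : Γ, γ • Circle.exp p = φ (Circle.exp p) := by
  have hk := hf.simpleZeros
  set Q : Set ℝ := {q | q ∈ Icc (-Real.pi) Real.pi ∩ {x | deriv (angular f) x = 0} ∧
    ¬ ∃ γ : Γ, γ • Circle.exp p = Circle.exp q} with hQ
  have hfin : Q.Finite := (hk.finite_Icc _ _).subset fun q hq => hq.1
  let S : ℝ → Set (invariantMetrics Γ) := fun q => {g |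
    deriv (deriv (angular f)) q * g.1.coeff p - g.1.coeff q * deriv (deriv (angular f)) p ≠ 0}
  have hS : ∀ q ∈ Q, IsOpen (S q) ∧ Dense (S q) := fun q hq =>
    isOpen_dense_eigenvalue_ne hs hf hq.1.2 hq.2
  have hfd : IsOpen (⋂ q ∈ Q, S q) ∧ Dense (⋂ q ∈ Q, S q) := by
    clear_value Q
    clear hQ
    induction Q, hfin using Set.Finite.induction_on with
    | empty => simp
    | @insert q Q' _ _ ih =>
      rw [biInter_insert]
      have h1 := hS q (mem_insert _ _)
      have h2 := ih fun q hq => hS q (mem_insert_of_mem _ hq)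
      exact ⟨h1.1.inter h2.1, h1.2.inter_of_isOpen_left h2.2 h1.1⟩
  refine ⟨_, hfd.1, hfd.2, fun g hg φ hφ => ?_⟩
  by_contra hno
  have he : φ (Circle.exp p) = Circle.exp (Complex.arg (φ (Circle.exp p))) :=
    (Circle.exp_arg _).symm
  have h := Aut_map_critical hf g.1 hφ hp he
  -- The image of `p` is critical, and `arg` picks its representative in the period on which
  -- finitely many conditions were imposed.
  have hmem : Complex.arg (φ (Circle.exp p)) ∈ Q :=
    ⟨⟨⟨(Complex.neg_pi_lt_arg _).le, Complex.arg_le_pi _⟩, h.1⟩, by rwa [← he]⟩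
  exact (mem_iInter₂.1 hg _ hmem) (sub_eq_zero.2 h.2)

/-- The isomorphism of `Γ` with `Aut(∇f)/ℝ`, from conditions on the orbit of a single point. -/
theorem nonempty_autModFlow_equiv [FaithfulSMul Γ Circle]
    (hs : ∀ γ : Γ, ContMDiff (𝓡 1) (𝓡 1) ∞ (fun z : Circle => γ • z)) (hf : IsMorse f)
    (hfΓ : ∀ (γ : Γ) (z : Circle), f (γ • z) = f z) {g : Metric} (hg : g ∈ invariantMetrics Γ)
    {p : ℝ}
    (h1 : ∀ φ ∈ Aut (grad g f), ∃ γ : Γ, Preserving (φ * toDiff hs γ : Diff))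
    (h2 : ∀ φ ∈ Aut (grad g f), ∃ γ : Γ, γ • Circle.exp p = φ (Circle.exp p))
    (h3 : ∀ γ : Γ, ∃ γ' : Γ, γ' • Circle.exp p = γ • Circle.exp p ∧ Preserving (toDiff hs γ')) :
    Nonempty (AutModFlow (grad g f) ≃* Γ) := by
  have hmem := toDiff_mem_Aut hs hf.1 hfΓ hg
  let F : Γ →* Aut (grad g f) := (toDiff hs).codRestrict _ hmem
  let H : Γ →* AutModFlow (grad g f) := (QuotientGroup.mk' (flowSubgroup (grad g f))).comp F
  have hinj : Function.Injective H := by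
    rw [injective_iff_map_eq_one]
    intro γ hγ
    have hγ' : F γ ∈ flowSubgroup (grad g f) := (QuotientGroup.eq_one_iff _).1 hγ
    refine eq_of_smul_eq_smul (α := Circle) fun z => ?_
    rw [one_smul]
    exact eq_one_of_mem_flowSubgroup hf g (F γ) (hfΓ γ) hγ' z
  have hsurj : Function.Surjective H := by
    intro x
    obtain ⟨φ, rfl⟩ := QuotientGroup.mk_surjective x
    -- First `γ₀` corrects the orientation; then `γ₂` undoes the motion of `p` without spoiling it.
    -- What remains fixes `p`, so it is a flow map.
    obtain ⟨γ₀, hγ₀⟩ := h1 φ φ.2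
    obtain ⟨γ₁, hγ₁⟩ := h2 (φ * toDiff hs γ₀) (mul_mem φ.2 (hmem γ₀))
    obtain ⟨γ₂, hγ₂, hpres⟩ := h3 γ₁
    rw [hγ₁] at hγ₂
    have hinv : Preserving (toDiff hs γ₂⁻¹) := by
      refine (preserving_or_reversing _).resolve_right fun hrev => ?_
      have := hrev.preserving_comp hpres
      rw [← map_mul, inv_mul_cancel, map_one] at this
      exact this.not_preserving ⟨id, ⟨contDiff_id, fun _ => rfl⟩, by simp⟩
    have hχ : (F γ₂)⁻¹ * (φ * F γ₀) ∈ flowSubgroup (grad g f) := by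
      refine mem_flowSubgroup_of_fixed (p := p) hf g _ ?_ ?_
      · have := hinv.comp hγ₀
        rw [← map_inv]
        exact this
      · rw [← map_inv]
        change γ₂⁻¹ • (φ * toDiff hs γ₀ : Diff) (Circle.exp p) = Circle.exp p
        rw [← hγ₂, inv_smul_smul]
    refine ⟨γ₂ * γ₀⁻¹, ?_⟩
    have h4 : H γ₂ = QuotientGroup.mk (φ * F γ₀) := QuotientGroup.eq.2 hχ
    rw [map_mul, h4, map_inv]
    change (QuotientGroup.mk φ : AutModFlow (grad g f)) * H γ₀ * (H γ₀)⁻¹ = _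
    rw [mul_inv_cancel_right]
  exact ⟨(MulEquiv.ofBijective H ⟨hinj, hsurj⟩).symm⟩

end Generic

end CircleGradient

theorem theorem2p1 (Γ : Type*) [Group Γ] [Finite Γ] [MulAction Γ Circle] [FaithfulSMul Γ Circle]
    (hsmooth : ∀ γ : Γ, ContMDiff (𝓡 1) (𝓡 1) ∞ (fun z : Circle => γ • z))
    (f : Circle → ℝ) (hf : CircleGradient.IsMorse f)
    (hfΓ : ∀ (γ : Γ) (z : Circle), f (γ • z) = f z) :
    ∃ U : Set (CircleGradient.invariantMetrics Γ), IsOpen U ∧ Dense U ∧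
      ∀ g ∈ U, Nonempty (CircleGradient.AutModFlow (CircleGradient.grad g.1 f) ≃* Γ) := by
  open CircleGradient in
  have hone : ∀ φ : Diff, φ * toDiff hsmooth 1 = φ := fun φ => by rw [map_one, mul_one]
  by_cases hrev : ∃ ρ : Γ, Reversing (toDiff hsmooth ρ)
  · obtain ⟨ρ, hρ⟩ := hrev
    obtain ⟨Φ, p, hΦ, hd, hp, n, hn⟩ := hρ.exists_fixed
    -- Invariance at the fixed point gives `f' * Φ' = f'` with `Φ' < 0`, so `f'` vanishes there.
    have hcrit : deriv (angular f) p = 0 := by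
      have h1 := IsLift.deriv_angular_mul hf.1 (hfΓ ρ) hΦ p
      have h2 : deriv (angular f) (Φ p) = deriv (angular f) p := by
        rw [hn]
        exact (deriv_periodic (angular_periodic f)).int_mul n p
      rw [h2] at h1
      nlinarith [hd p, mul_self_nonneg (deriv (angular f) p)]
    obtain ⟨W, hWo, hWd, hW⟩ := exists_isOpen_dense_orbit hsmooth hf hcrit
    refine ⟨W, hWo, hWd, fun g hg => nonempty_autModFlow_equiv hsmooth hf hfΓ g.2 (p := p)
      (fun φ _ => ?_) (hW g hg) fun γ => ?_⟩
    · rcases preserving_or_reversing φ with h | h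
      · exact ⟨1, by rwa [hone]⟩
      · exact ⟨ρ, h.comp hρ⟩
    · rcases preserving_or_reversing (toDiff hsmooth γ) with h | h
      · exact ⟨γ, rfl, h⟩
      -- Since `ρ` fixes `p`, this changes the orientation of `γ` but not the image of `p`.
      · refine ⟨γ * ρ, ?_, ?_⟩
        · rw [mul_smul]
          exact congrArg (γ • ·) hp
        · rw [map_mul]
          exact h.comp hρ
  · have hpres : ∀ γ : Γ, Preserving (toDiff hsmooth γ) := fun γ =>
      (preserving_or_reversing _).resolve_right fun h => hrev ⟨γ, h⟩
    obtain ⟨p, hp⟩ := exists_critical hf.1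
    obtain ⟨W, hWo, hWd, hW⟩ := exists_isOpen_dense_orbit hsmooth hf hp
    obtain ⟨hVo, hVd⟩ := isOpen_dense_principalValue_ne hsmooth hf hfΓ hpres
    refine ⟨_, hVo.inter hWo, hVd.inter_of_isOpen_left hWd hVo, fun g hg =>
      nonempty_autModFlow_equiv hsmooth hf hfΓ g.2 (p := p) (fun φ hφ => ⟨1, ?_⟩) (hW g hg.2)
        fun γ => ⟨γ, rfl, hpres γ⟩⟩
    rw [hone]
    exact (preserving_or_reversing φ).resolve_right (not_reversing hf g.1 hg.1 hφ)
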